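/- A noncompact metric graph $G$ is a connected graph obtained by gluing, at some of their endpoints, finitely many closed intervals: bounded edges $e\cong[0,\ell_e]$ with $0<\ell_e<\infty$, and at least one half-line $\cong[0,\infty)$ (self-loops and multiple edges are allowed). A terminal point of $G$ is a vertex of degree one, where a self-loop counts twice and the points at infinity of the half-lines are not points of $G$. The space $H^1(G)$ consists of the continuous functions $u:G\to\mathbb C$ that, on the interior of every edge and half-line, belong to $L^2$ and have a weak derivative $u'$ in $L^2$. For $\mu>0$ let $H^1_\mu(G)=\{u\in H^1(G):\|u\|_{L^2(G)}^2=\mu\}$. Let $\mu_{\mathbb R}=\pi\sqrt3/2$ be the critical mass of the real line. **Lemma (modified Gagliardo–Nirenberg inequality).** Let $G$ be a noncompact metric graph with no terminal point. Then there is a constant $C>0$, depending only on $G$, such that for every $\mu\in(0,\mu_{\mathbb R}]$ and every $u\in H^1_\mu(G)$ there exists $\theta\in[0,\mu]$ with $$\|u\|_{L^6(G)}^6\le 3\left(\frac{\mu-\theta}{\mu_{\mathbb R}}\right)^2\|u'\|_{L^2(G)}^2+C\,\theta^{1/2}.$$ -/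

import Mathlib

open MeasureTheory Set
open scoped ContDiff

noncomputable section

/-- A connected metric graph with vertices `V`, bounded edges `E` and half-lines `H`
(in the theorem all three are finite). The bounded edge `e` is a copy of `[0, length e]`
whose end `0` is glued to `src e` and whose end `length e` is glued to `tgt e`; the half-line
`h` is a copy of `[0, ∞)` whose origin is glued to `base h`. Self-loops and multiple edges are
allowed. The points at infinity of the half-lines are not points of the graph and are not
vertices here. -/
structure MetricGraph (V E H : Type*) where
  src : E → V
  tgt : E → V
  length : E → ℝ
  length_pos : ∀ e, 0 < length e
  base : H → V
  connected : (SimpleGraph.fromRel fun v w => ∃ e, src e = v ∧ tgt e = w).Connected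

namespace MetricGraph

variable {V E H : Type*}

/-- The degree of a vertex; a self-loop counts twice. -/
def degree (G : MetricGraph V E H) (v : V) : ℕ :=
  Nat.card {e : E // G.src e = v} + Nat.card {e : E // G.tgt e = v}
    + Nat.card {h : H // G.base h = v}

/-- The vertex `v` is a terminal point (a tip): a vertex of degree one. -/
def IsTerminal (G : MetricGraph V E H) (v : V) : Prop := G.degree v = 1

/-- The points of the metric graph: its vertices, and the interior points of its bounded edges
and of its half-lines. -/
inductive Point (G : MetricGraph V E H) where
  | vertex (v : V) : Point G
  | inEdge (e : E) (t : Ioo (0 : ℝ) (G.length e)) : Point G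
  | inRay (h : H) (t : Ioi (0 : ℝ)) : Point G

open Classical in
/-- The parametrization of the closed edge `e` by `[0, length e]` (constant outside). -/
def edgePt (G : MetricGraph V E H) (e : E) (t : ℝ) : G.Point :=
  if ht : t ∈ Ioo (0 : ℝ) (G.length e) then .inEdge e ⟨t, ht⟩
  else if t ≤ 0 then .vertex (G.src e) else .vertex (G.tgt e)

open Classical in
/-- The parametrization of the closed half-line `h` by `[0, ∞)` (constant outside). -/
def rayPt (G : MetricGraph V E H) (h : H) (t : ℝ) : G.Point :=
  if ht : t ∈ Ioi (0 : ℝ) then .inRay h ⟨t, ht⟩ else .vertex (G.base h)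

theorem edgePt_zero (G : MetricGraph V E H) (e : E) :
    G.edgePt e 0 = .vertex (G.src e) := by
  simp [edgePt]

theorem edgePt_length (G : MetricGraph V E H) (e : E) :
    G.edgePt e (G.length e) = .vertex (G.tgt e) := by
  simp [edgePt, G.length_pos e]

theorem rayPt_zero (G : MetricGraph V E H) (h : H) :
    G.rayPt h 0 = .vertex (G.base h) := by
  simp [rayPt]

/-- The integral over the metric graph: the sum of the Lebesgue integrals over the bounded edges
and over the half-lines. -/
def integral [Fintype E] [Fintype H] (G : MetricGraph V E H) (f : G.Point → ℝ) : ℝ :=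
  (∑ e : E, (∫ t in Ioo (0 : ℝ) (G.length e), f (G.edgePt e t)))
    + ∑ h : H, (∫ t in Ioi (0 : ℝ), f (G.rayPt h t))

end MetricGraph

/-- `u` belongs to the Sobolev space `H¹(s)` of the open set `s ⊆ ℝ` and `du` is its weak
derivative: both are in `L²(s)`, and integration by parts holds against all smooth functions
compactly supported in `s`. -/
structure IsSobolevH1 (s : Set ℝ) (u du : ℝ → ℂ) : Prop where
  memLp : MemLp u 2 (volume.restrict s)
  memLp_deriv : MemLp du 2 (volume.restrict s)
  weak_deriv : ∀ φ : ℝ → ℝ, ContDiff ℝ ∞ φ → HasCompactSupport φ → tsupport φ ⊆ s →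
    ∫ t in s, ((deriv φ t : ℝ) : ℂ) * u t = -∫ t in s, ((φ t : ℝ) : ℂ) * du t

namespace MetricGraph

variable {V E H : Type*}

/-- `u ∈ H¹(G)` with weak derivative `du`: `u` is continuous on the graph, that is, its
restriction to every closed edge is continuous (vertices are shared by the edges that are glued
there), and on the interior of every edge `u` is in `H¹` with weak derivative `du`, taken in the
coordinate of that edge. The values of `du` at the vertices play no role. -/
structure IsH1 (G : MetricGraph V E H) (u du : G.Point → ℂ) : Prop where
  continuousOn_edge : ∀ e, ContinuousOn (fun t => u (G.edgePt e t)) (Icc 0 (G.length e))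
  continuousOn_ray : ∀ h, ContinuousOn (fun t => u (G.rayPt h t)) (Ici 0)
  edge : ∀ e, IsSobolevH1 (Ioo 0 (G.length e))
    (fun t => u (G.edgePt e t)) (fun t => du (G.edgePt e t))
  ray : ∀ h, IsSobolevH1 (Ioi 0) (fun t => u (G.rayPt h t)) (fun t => du (G.rayPt h t))

end MetricGraph

/-- The critical mass `μ_ℝ = π √3 / 2` of the real line. -/
def criticalMassReal : ℝ := Real.pi * √3 / 2

end

/-! The proof is a calibration argument. Let `M` be the maximum of `|u|`. The soliton of height `M`
satisfies `3 φ'² = M⁴ φ² - φ⁶`, so with `k(r) = r √((M⁴ - r⁴)/3)` completing a square gives,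
pointwise and for every `a`, `a²|u|⁶ + 6a k(|u|)|u'| ≤ 3|u'|² + a² M⁴ |u|²`. The integral of
`k(|u|)|u'|` controls the variation of `Φ(|u|)`, where `Φ' = k`, and `12 Φ(M) = μ_ℝ M⁴`. If `|u|`
descended from `M` to `0` along two disjoint paths, the choice `a = μ_ℝ/μ` would give the inequality
with `θ = 0`.

Since no vertex is terminal, two disjoint paths do start at a maximum point: one continues along its
edge, the other goes back to the nearer vertex and leaves through a different edge end. Each has a
segment of fixed length `L` available, on which `|u|` need only drop to some level `t`. So `k` is
cut off below `t`, at a cost of order `M² t²` in `Φ(M)` (`le_calibPrim`). In return, the mass `η`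
lying below `t` no longer needs the factor `M⁴`. With `θ = η/2` the error is at most `14 M² t² - M⁴
η/2 + t⁴ η` (`le_of_calibration`), hence at most `98 t⁴/η + t⁴ η`.

This is `O(√η)` as soon as `t` is bounded and `η ≥ c t^(8/3)`; writing `t = r³` turns this into `η ≥
c r⁸`. Such a level exists (`exists_level_le_integral_ite`): if every sublevel set carried less
mass, a dyadic summation would make the sublevel sets too small to fill a segment of length `L`. -/

noncomputable section

open Filter Topology

/-! ### Increments of one-dimensional Sobolev functions -/

/-- A smooth step rising from `0` to `1` on `[p, p + ε]`. -/
def smoothStep (ε p t : ℝ) : ℝ := Real.smoothTransition ((t - p) / ε)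

theorem contDiff_smoothStep (ε p : ℝ) : ContDiff ℝ ∞ (smoothStep ε p) :=
  Real.smoothTransition.contDiff.comp ((contDiff_id.sub contDiff_const).div_const ε)

theorem smoothStep_eq_zero {ε p t : ℝ} (hε : 0 < ε) (ht : t ≤ p) : smoothStep ε p t = 0 :=
  Real.smoothTransition.zero_of_nonpos (div_nonpos_of_nonpos_of_nonneg (by linarith) hε.le)

theorem smoothStep_eq_one {ε p t : ℝ} (hε : 0 < ε) (ht : p + ε ≤ t) : smoothStep ε p t = 1 :=
  Real.smoothTransition.one_of_one_le ((one_le_div hε).2 (by linarith))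

theorem monotone_smoothStep {ε : ℝ} (hε : 0 < ε) (p : ℝ) : Monotone (smoothStep ε p) :=
  fun a b h => Real.smoothTransition.monotone
    (div_le_div_of_nonneg_right (by linarith) hε.le)

theorem deriv_smoothStep_nonneg {ε : ℝ} (hε : 0 < ε) (p t : ℝ) : 0 ≤ deriv (smoothStep ε p) t :=
  (monotone_smoothStep hε p).deriv_nonneg

theorem deriv_smoothStep_eq_zero {ε p t : ℝ} (hε : 0 < ε) (ht : t < p ∨ p + ε < t) :
    deriv (smoothStep ε p) t = 0 := by
  rcases ht with ht | ht
  · have : smoothStep ε p =ᶠ[𝓝 t] fun _ => 0 := by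
      filter_upwards [Iio_mem_nhds ht] with s hs using smoothStep_eq_zero hε (le_of_lt hs)
    rw [this.deriv_eq, deriv_const]
  · have : smoothStep ε p =ᶠ[𝓝 t] fun _ => 1 := by
      filter_upwards [Ioi_mem_nhds ht] with s hs using smoothStep_eq_one hε (le_of_lt hs)
    rw [this.deriv_eq, deriv_const]

theorem continuous_deriv_smoothStep (ε p : ℝ) : Continuous (deriv (smoothStep ε p)) :=
  (contDiff_smoothStep ε p).continuous_deriv (by simp)

theorem integral_deriv_smoothStep {ε p x z : ℝ} (hε : 0 < ε) (hx : x ≤ p) (hz : p + ε ≤ z) :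
    ∫ t in x..z, deriv (smoothStep ε p) t = 1 := by
  rw [intervalIntegral.integral_deriv_eq_sub
    (fun t _ => (contDiff_smoothStep ε p).differentiable (by simp) t)
    ((continuous_deriv_smoothStep ε p).intervalIntegrable _ _),
    smoothStep_eq_one hε hz, smoothStep_eq_zero hε hx, sub_zero]

theorem intervalIntegrable_deriv_smoothStep_mul {u : ℝ → ℂ} {x z : ℝ} (ε p : ℝ) (hxz : x ≤ z)
    (hu : ContinuousOn u (Icc x z)) :
    IntervalIntegrable (fun t => ((deriv (smoothStep ε p) t : ℝ) : ℂ) * u t) volume x z := by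
  apply ContinuousOn.intervalIntegrable
  rw [uIcc_of_le hxz]
  exact (Complex.continuous_ofReal.comp (continuous_deriv_smoothStep ε p)).continuousOn.mul hu

/-- The derivative of the step is a nonnegative kernel of mass one carried by `[p, p + ε]`, so it
acts as an approximate Dirac mass at `p`. -/
theorem norm_integral_deriv_smoothStep_mul_sub_le {u : ℝ → ℂ} {ε p x z δ : ℝ} (hε : 0 < ε)
    (hx : x ≤ p) (hz : p + ε ≤ z) (hu : ContinuousOn u (Icc x z))
    (hδ : ∀ t ∈ Icc p (p + ε), ‖u t - u p‖ ≤ δ) :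
    ‖(∫ t in x..z, ((deriv (smoothStep ε p) t : ℝ) : ℂ) * u t) - u p‖ ≤ δ := by
  have hxz : x ≤ z := by linarith
  have h1 : u p = ∫ t in x..z, ((deriv (smoothStep ε p) t : ℝ) : ℂ) * u p := by
    rw [intervalIntegral.integral_mul_const, intervalIntegral.integral_ofReal,
      integral_deriv_smoothStep hε hx hz]
    simp
  have h2 : (∫ t in x..z, ((deriv (smoothStep ε p) t : ℝ) : ℂ) * u t) - u p
      = ∫ t in x..z, ((deriv (smoothStep ε p) t : ℝ) : ℂ) * (u t - u p) := by
    conv_lhs => rw [h1]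
    rw [← intervalIntegral.integral_sub (intervalIntegrable_deriv_smoothStep_mul ε p hxz hu)
      (intervalIntegrable_deriv_smoothStep_mul ε p hxz continuousOn_const)]
    simp only [mul_sub]
  rw [h2]
  calc _ ≤ ∫ t in x..z, deriv (smoothStep ε p) t * δ := by
        apply intervalIntegral.norm_integral_le_of_norm_le hxz _
          (((continuous_deriv_smoothStep ε p).mul continuous_const).intervalIntegrable _ _)
        refine Eventually.of_forall fun t _ => ?_
        rw [norm_mul, Complex.norm_real, Real.norm_of_nonneg (deriv_smoothStep_nonneg hε p t)]
        by_cases ht : t ∈ Icc p (p + ε)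
        · exact mul_le_mul_of_nonneg_left (hδ t ht) (deriv_smoothStep_nonneg hε p t)
        · simp only [mem_Icc, not_and_or, not_le] at ht
          simp [deriv_smoothStep_eq_zero hε ht]
    _ = δ := by
        rw [intervalIntegral.integral_mul_const, integral_deriv_smoothStep hε hx hz, one_mul]

theorem MeasureTheory.MemLp.intervalIntegrable_norm {s : Set ℝ} {f : ℝ → ℂ} {x y : ℝ}
    (hf : MemLp f 2 (volume.restrict s)) (hxy : x ≤ y) (hs : Ioo x y ⊆ s) :
    IntervalIntegrable (fun t => ‖f t‖) volume x y := by
  rw [intervalIntegrable_iff_integrableOn_Ioo_of_le hxy]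
  have h : MemLp f 2 (volume.restrict (Ioo x y)) := hf.mono_measure (Measure.restrict_mono_set _ hs)
  exact (h.integrable (by norm_num)).norm

/-- The test function `smoothStep ε x - smoothStep ε y` bounds the increment of `u`. -/
theorem IsSobolevH1.norm_sub_le_of_lt {s : Set ℝ} {u du : ℝ → ℂ} (h : IsSobolevH1 s u du)
    (hs : MeasurableSet s) {x y z : ℝ} (hxy : x < y) (hyz : y < z) (hsub : Icc x z ⊆ s)
    (hu : ContinuousOn u (Icc x z)) : ‖u y - u x‖ ≤ ∫ t in x..z, ‖du t‖ := by
  have hxz : x ≤ z := (hxy.trans hyz).le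
  have key : ∀ δ > 0, ‖u y - u x‖ ≤ (∫ t in x..z, ‖du t‖) + 2 * δ := by
    intro δ hδ
    obtain ⟨r, hr, hur⟩ := Metric.uniformContinuousOn_iff_le.1
      (isCompact_Icc.uniformContinuousOn_of_continuous hu) δ hδ
    -- `r` keeps the oscillation of `u` on each transition interval below `δ`; `z - y` keeps the
    -- second transition inside `[x, z]`.
    set ε := min r (z - y) with hεdef
    have hε : 0 < ε := lt_min hr (by linarith)
    have hε1 : ε ≤ r := min_le_left _ _
    have hε2 : ε ≤ z - y := min_le_right _ _
    have hosc : ∀ p ∈ Icc x y, ∀ t ∈ Icc p (p + ε), ‖u t - u p‖ ≤ δ := by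
      intro p hp t ht
      rw [← dist_eq_norm]
      refine hur t ⟨by linarith [hp.1, ht.1], by linarith [hp.2, ht.2]⟩ p
        ⟨hp.1, by linarith [hp.2]⟩ ?_
      rw [Real.dist_eq, abs_of_nonneg (by linarith [ht.1])]
      linarith [ht.2]
    have bx := norm_integral_deriv_smoothStep_mul_sub_le (z := z) hε le_rfl (by linarith) hu
      (hosc x ⟨le_rfl, hxy.le⟩)
    have by' := norm_integral_deriv_smoothStep_mul_sub_le (z := z) hε hxy.le (by linarith) hu
      (hosc y ⟨hxy.le, le_rfl⟩)
    -- `φ'` approximates a Dirac mass at `x` minus one at `y`, so the weak formulation nearly reads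
    -- `u x - u y = -∫ φ du`, with `|φ| ≤ 1`.
    set φ : ℝ → ℝ := fun t => smoothStep ε x t - smoothStep ε y t with hφ
    have hφ0 : ∀ t, t ∉ Icc x z → φ t = 0 := by
      intro t ht
      simp only [mem_Icc, not_and_or, not_le] at ht
      rcases ht with ht | ht
      · simp [hφ, smoothStep_eq_zero hε ht.le, smoothStep_eq_zero hε (ht.le.trans hxy.le)]
      · simp [hφ, smoothStep_eq_one hε (show x + ε ≤ t by linarith),
          smoothStep_eq_one hε (show y + ε ≤ t by linarith)]
    have hφ1 : ∀ t, |φ t| ≤ 1 := by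
      intro t
      have := Real.smoothTransition.nonneg ((t - x) / ε)
      have := Real.smoothTransition.nonneg ((t - y) / ε)
      have := Real.smoothTransition.le_one ((t - x) / ε)
      have := Real.smoothTransition.le_one ((t - y) / ε)
      simp only [hφ, smoothStep]
      rw [abs_le]; constructor <;> linarith
    have hdφ : ∀ t, deriv φ t = deriv (smoothStep ε x) t - deriv (smoothStep ε y) t := fun t =>
      deriv_fun_sub ((contDiff_smoothStep ε x).differentiable (by simp) t)
        ((contDiff_smoothStep ε y).differentiable (by simp) t)
    have hts : tsupport φ ⊆ Icc x z :=
      closure_minimal (fun t ht => by by_contra hc; exact ht (hφ0 t hc)) isClosed_Icc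
    have hw := h.weak_deriv φ ((contDiff_smoothStep ε x).sub (contDiff_smoothStep ε y))
      (isCompact_Icc.of_isClosed_subset (isClosed_tsupport φ) hts) (hts.trans hsub)
    have hrest : ∀ g : ℝ → ℂ, (∀ t, t ∉ Icc x z → g t = 0) → ∫ t in s, g t = ∫ t in x..z, g t := by
      intro g hg
      rw [intervalIntegral.integral_of_le hxz, ← integral_Icc_eq_integral_Ioc]
      exact setIntegral_eq_of_subset_of_forall_sdiff_eq_zero hs hsub fun t ht => hg t ht.2
    rw [hrest, hrest] at hw
    rotate_left
    · intro t ht; rw [hφ0 t ht]; simp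
    · intro t ht
      rw [hdφ]
      simp only [mem_Icc, not_and_or, not_le] at ht
      rcases ht with ht | ht
      · rw [deriv_smoothStep_eq_zero hε (Or.inl ht),
          deriv_smoothStep_eq_zero hε (Or.inl (ht.trans hxy))]; simp
      · rw [deriv_smoothStep_eq_zero hε (Or.inr (show x + ε < t by linarith)),
          deriv_smoothStep_eq_zero hε (Or.inr (show y + ε < t by linarith))]; simp
    have hsplit : ∫ t in x..z, ((deriv φ t : ℝ) : ℂ) * u t
        = (∫ t in x..z, ((deriv (smoothStep ε x) t : ℝ) : ℂ) * u t)
          - ∫ t in x..z, ((deriv (smoothStep ε y) t : ℝ) : ℂ) * u t := by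
      rw [← intervalIntegral.integral_sub (intervalIntegrable_deriv_smoothStep_mul ε x hxz hu)
        (intervalIntegrable_deriv_smoothStep_mul ε y hxz hu)]
      simp only [hdφ, Complex.ofReal_sub, sub_mul]
    have hint := h.memLp_deriv.intervalIntegrable_norm hxz (Ioo_subset_Icc_self.trans hsub)
    have hbd : ‖∫ t in x..z, ((φ t : ℝ) : ℂ) * du t‖ ≤ ∫ t in x..z, ‖du t‖ := by
      apply intervalIntegral.norm_integral_le_of_norm_le hxz _ hint
      refine Eventually.of_forall fun t _ => ?_
      rw [norm_mul, Complex.norm_real]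
      exact mul_le_of_le_one_left (norm_nonneg _) (hφ1 t)
    set Ix := ∫ t in x..z, ((deriv (smoothStep ε x) t : ℝ) : ℂ) * u t
    set Iy := ∫ t in x..z, ((deriv (smoothStep ε y) t : ℝ) : ℂ) * u t
    set J := ∫ t in x..z, ((φ t : ℝ) : ℂ) * du t
    have e1 : u y - u x = J + (Ix - u x) - (Iy - u y) := by
      rw [hsplit] at hw
      linear_combination -hw
    rw [e1]
    calc _ ≤ ‖J‖ + ‖Ix - u x‖ + ‖Iy - u y‖ :=
          (norm_sub_le _ _).trans (add_le_add_left (norm_add_le _ _) _)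
      _ ≤ _ := by linarith
  refine le_of_forall_pos_le_add fun δ hδ => ?_
  have := key (δ / 2) (by positivity)
  linarith

/-- A Sobolev function which is continuous up to the boundary is controlled by its weak
derivative, on intervals whose interior lies in the domain. -/
theorem IsSobolevH1.norm_sub_le {s : Set ℝ} {u du : ℝ → ℂ} (h : IsSobolevH1 s u du)
    (hs : MeasurableSet s) {x y : ℝ} (hxy : x ≤ y) (hsub : Ioo x y ⊆ s)
    (hu : ContinuousOn u (Icc x y)) : ‖u y - u x‖ ≤ ∫ t in x..y, ‖du t‖ := by
  rcases hxy.eq_or_lt with rfl | hlt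
  · simp
  have hint := h.memLp_deriv.intervalIntegrable_norm hxy hsub
  -- For interior points there is room to the right of `b` for the transition of the test function.
  -- The endpoints are then reached by continuity.
  have inner : ∀ a ∈ Ioo x y, ∀ b ∈ Ioo x y, a ≤ b → ‖u b - u a‖ ≤ ∫ t in x..y, ‖du t‖ := by
    intro a ha b hb hab
    rcases hab.eq_or_lt with rfl | hab
    · simpa using intervalIntegral.integral_nonneg hxy fun t _ => norm_nonneg (du t)
    obtain ⟨c, hbc, hcy⟩ := exists_between hb.2
    have hsub' : Icc a c ⊆ Ioo x y := fun t ht => ⟨ha.1.trans_le ht.1, ht.2.trans_lt hcy⟩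
    refine (h.norm_sub_le_of_lt hs hab hbc (hsub'.trans hsub)
      (hu.mono (hsub'.trans Ioo_subset_Icc_self))).trans ?_
    exact intervalIntegral.integral_mono_interval ha.1.le (hab.trans hbc).le hcy.le
      (Eventually.of_forall fun t => norm_nonneg _) hint
  have hx : Tendsto (fun n : ℝ => u (x + n)) (𝓝[>] 0) (𝓝 (u x)) := by
    have h1 : Tendsto u (𝓝[Icc x y] x) (𝓝 (u x)) := hu x ⟨le_rfl, hxy⟩
    refine h1.comp (tendsto_nhdsWithin_iff.2 ⟨?_, ?_⟩)
    · have : Tendsto (fun n : ℝ => x + n) (𝓝 0) (𝓝 (x + 0)) := tendsto_const_nhds.add tendsto_id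
      rw [add_zero] at this
      exact this.mono_left nhdsWithin_le_nhds
    · filter_upwards [Ioo_mem_nhdsGT (show 0 < y - x by linarith)] with n hn
      exact ⟨by linarith [hn.1], by linarith [hn.2]⟩
  have hy : Tendsto (fun n : ℝ => u (y - n)) (𝓝[>] 0) (𝓝 (u y)) := by
    have h1 : Tendsto u (𝓝[Icc x y] y) (𝓝 (u y)) := hu y ⟨hxy, le_rfl⟩
    refine h1.comp (tendsto_nhdsWithin_iff.2 ⟨?_, ?_⟩)
    · have : Tendsto (fun n : ℝ => y - n) (𝓝 0) (𝓝 (y - 0)) := tendsto_const_nhds.sub tendsto_id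
      rw [sub_zero] at this
      exact this.mono_left nhdsWithin_le_nhds
    · filter_upwards [Ioo_mem_nhdsGT (show 0 < y - x by linarith)] with n hn
      exact ⟨by linarith [hn.2], by linarith [hn.1]⟩
  refine le_of_tendsto (hy.sub hx).norm ?_
  filter_upwards [Ioo_mem_nhdsGT (show 0 < (y - x) / 2 by linarith)] with n hn
  obtain ⟨h1, h2⟩ := hn
  exact inner _ ⟨by linarith, by linarith⟩ _ ⟨by linarith, by linarith⟩ (by linarith)

/-! ### Chain rule for dominated increments, and decay on half-lines -/

/-- Chain rule inequality: if the increments of `f` are dominated by `∫ w`, then the increments of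
`Ψ ∘ f` are dominated by `∫ |Ψ' ∘ f| w`. -/
theorem comp_sub_le_integral_of_sub_le {f w Ψ ψ : ℝ → ℝ} {a b : ℝ} (hab : a ≤ b)
    (hw : IntervalIntegrable w volume a b) (hw0 : ∀ t, 0 ≤ w t)
    (hf : ContinuousOn f (Icc a b))
    (hfw : ∀ x ∈ Icc a b, ∀ y ∈ Icc a b, x ≤ y → |f y - f x| ≤ ∫ t in x..y, w t)
    (hΨ : ∀ r, HasDerivAt Ψ (ψ r) r) (hψ : Continuous ψ) :
    Ψ (f b) - Ψ (f a) ≤ ∫ t in a..b, |ψ (f t)| * w t := by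
  have hΨc : Continuous Ψ := continuous_iff_continuousAt.2 fun r => (hΨ r).continuousAt
  have hwi : ∀ x ∈ Icc a b, ∀ y ∈ Icc a b, IntervalIntegrable w volume x y := fun x hx y hy =>
    hw.mono_set (by rw [uIcc_of_le hab]; exact uIcc_subset_Icc hx hy)
  have hψf : ContinuousOn (fun t => |ψ (f t)|) (Icc a b) := (hψ.comp_continuousOn hf).abs
  have hgi : ∀ c, ∀ x ∈ Icc a b, ∀ y ∈ Icc a b,
      IntervalIntegrable (fun t => (|ψ (f t)| + c) * w t) volume x y := fun c x hx y hy =>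
    (hwi x hx y hy).continuousOn_mul
      ((hψf.add continuousOn_const).mono (uIcc_subset_Icc hx hy))
  have haI : a ∈ Icc a b := left_mem_Icc.2 hab
  have hbI : b ∈ Icc a b := right_mem_Icc.2 hab
  -- Continuous induction along `[a, b]`. The slack `ε` permits a step to the right: near any point,
  -- the Lipschitz bound `|ψ (f x)| + ε / 2` is at most `|ψ (f t)| + ε`. No differentiability of `f`
  -- is needed.
  have key : ∀ ε > 0, Ψ (f b) - Ψ (f a) ≤ ∫ t in a..b, (|ψ (f t)| + ε) * w t := by
    intro ε hε
    set s : Set ℝ := {x | Ψ (f x) - Ψ (f a) ≤ ∫ t in a..x, (|ψ (f t)| + ε) * w t} with hs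
    have hcl : IsClosed (s ∩ Icc a b) := by
      have hc1 : ContinuousOn (fun x => Ψ (f x) - Ψ (f a)) (Icc a b) :=
        (hΨc.comp_continuousOn hf).sub continuousOn_const
      have hc2 : ContinuousOn (fun x => ∫ t in a..x, (|ψ (f t)| + ε) * w t) (Icc a b) := by
        have := intervalIntegral.continuousOn_primitive_interval (μ := volume)
          (f := fun t => (|ψ (f t)| + ε) * w t) (a := a) (b := b)
          (by rw [uIcc_of_le hab]; exact (intervalIntegrable_iff_integrableOn_Icc_of_le hab).1
                (hgi ε a haI b hbI))
        rwa [uIcc_of_le hab] at this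
      have := isClosed_Icc.isClosed_le hc1 hc2
      convert this using 1
      ext x; simp [hs, and_comm]
    have hsub : Icc a b ⊆ s := by
      refine hcl.Icc_subset_of_forall_exists_gt (by simp [hs]) ?_
      rintro x ⟨hxs, hxab⟩ y hxy
      have hxI : x ∈ Icc a b := ⟨hxab.1, hxab.2.le⟩
      have hfx := hf x hxI
      have hU : ∀ᶠ r in 𝓝 (f x), |ψ r| < |ψ (f x)| + ε / 2 :=
        (hψ.abs.tendsto (f x)).eventually_lt_const (by linarith)
      obtain ⟨δ, hδ, hball⟩ := Metric.eventually_nhds_iff_ball.1 hU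
      have hV : ∀ᶠ t in 𝓝[Icc a b] x, f t ∈ Metric.ball (f x) δ ∧
          |ψ (f x)| - ε / 2 < |ψ (f t)| :=
        (hfx.eventually (Metric.ball_mem_nhds _ hδ)).and
          ((hψf x hxI).eventually_const_lt (by linarith))
      obtain ⟨ρ, hρ, hρball⟩ := Metric.mem_nhdsWithin_iff.1 hV
      set z := min (x + ρ / 2) (min y b) with hz
      have hxz : x < z := lt_min (by linarith) (lt_min hxy hxab.2)
      have hzb : z ≤ b := (min_le_right _ _).trans (min_le_right _ _)
      have hzy : z ≤ y := (min_le_right _ _).trans (min_le_left _ _)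
      have hzρ : z ≤ x + ρ / 2 := min_le_left _ _
      have hzI : z ∈ Icc a b := ⟨hxab.1.trans hxz.le, hzb⟩
      have hloc : ∀ t ∈ Icc x z, f t ∈ Metric.ball (f x) δ ∧ |ψ (f x)| - ε / 2 < |ψ (f t)| := by
        intro t ht
        refine hρball ⟨?_, hxab.1.trans ht.1, ht.2.trans hzb⟩
        rw [Metric.mem_ball, Real.dist_eq, abs_of_nonneg (by linarith [ht.1])]
        linarith [ht.2]
      refine ⟨z, ?_, hxz, hzy⟩
      have h1 : Ψ (f z) - Ψ (f x) ≤ (|ψ (f x)| + ε / 2) * |f z - f x| := by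
        have := (convex_ball (f x) δ).norm_image_sub_le_of_norm_hasDerivWithin_le
          (fun r _ => (hΨ r).hasDerivWithinAt) (fun r hr => (hball r hr).le)
          (Metric.mem_ball_self hδ) (hloc z ⟨hxz.le, le_rfl⟩).1
        exact (le_abs_self _).trans this
      have h2 : (|ψ (f x)| + ε / 2) * |f z - f x| ≤ ∫ t in x..z, (|ψ (f t)| + ε) * w t := by
        refine (mul_le_mul_of_nonneg_left (hfw x hxI z hzI hxz.le) (by positivity)).trans ?_
        rw [← intervalIntegral.integral_const_mul]
        refine intervalIntegral.integral_mono_on hxz.le ((hwi x hxI z hzI).const_mul _)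
          (hgi ε x hxI z hzI) fun t ht => ?_
        have := (hloc t ht).2
        exact mul_le_mul_of_nonneg_right (by linarith) (hw0 t)
      have h3 := intervalIntegral.integral_add_adjacent_intervals (hgi ε a haI x hxI)
        (hgi ε x hxI z hzI)
      simp only [hs, mem_ofPred_eq] at hxs ⊢
      linarith
    exact hsub hbI
  have hlim : Tendsto (fun ε : ℝ => ∫ t in a..b, (|ψ (f t)| + ε) * w t) (𝓝[>] 0)
      (𝓝 (∫ t in a..b, |ψ (f t)| * w t)) := by
    have e : (fun ε : ℝ => ∫ t in a..b, (|ψ (f t)| + ε) * w t)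
        = fun ε => (∫ t in a..b, |ψ (f t)| * w t) + ε * ∫ t in a..b, w t := by
      funext ε
      rw [← intervalIntegral.integral_const_mul, ← intervalIntegral.integral_add
        (by simpa using hgi 0 a haI b hbI) (hw.const_mul ε)]
      simp only [add_mul]
    rw [e]
    have : Tendsto (fun ε : ℝ => (∫ t in a..b, |ψ (f t)| * w t) + ε * ∫ t in a..b, w t) (𝓝 0)
        (𝓝 ((∫ t in a..b, |ψ (f t)| * w t) + 0 * ∫ t in a..b, w t)) :=
      tendsto_const_nhds.add (tendsto_id.mul_const _)
    rw [zero_mul, add_zero] at this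
    exact this.mono_left nhdsWithin_le_nhds
  exact ge_of_tendsto hlim (by filter_upwards [self_mem_nhdsWithin] with ε hε using key ε hε)

/-- Two-sided form of `comp_sub_le_integral_of_sub_le`. -/
theorem abs_comp_sub_le_integral {f w Ψ ψ : ℝ → ℝ} {a b : ℝ} (hab : a ≤ b)
    (hw : IntervalIntegrable w volume a b) (hw0 : ∀ t, 0 ≤ w t)
    (hf : ContinuousOn f (Icc a b))
    (hfw : ∀ x ∈ Icc a b, ∀ y ∈ Icc a b, x ≤ y → |f y - f x| ≤ ∫ t in x..y, w t)
    (hΨ : ∀ r, HasDerivAt Ψ (ψ r) r) (hψ : Continuous ψ) :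
    |Ψ (f b) - Ψ (f a)| ≤ ∫ t in a..b, |ψ (f t)| * w t := by
  have h1 := comp_sub_le_integral_of_sub_le hab hw hw0 hf hfw hΨ hψ
  have h2 := comp_sub_le_integral_of_sub_le hab hw hw0 hf hfw (fun r => (hΨ r).neg) hψ.neg
  simp only [Pi.neg_apply, abs_neg] at h2
  exact abs_le.2 ⟨by linarith, h1⟩

/-- A continuous square integrable function on a half-line, with increments dominated by a square
integrable `w`, tends to zero at infinity. -/
theorem tendsto_zero_of_sub_le {f w : ℝ → ℝ} (hf0 : ∀ t, 0 ≤ f t) (hw0 : ∀ t, 0 ≤ w t)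
    (hf : ContinuousOn f (Ici 0)) (hf2 : MemLp f 2 (volume.restrict (Ioi 0)))
    (hw2 : MemLp w 2 (volume.restrict (Ioi 0)))
    (hfw : ∀ x y, 0 ≤ x → x ≤ y → |f y - f x| ≤ ∫ t in x..y, w t) :
    Tendsto f atTop (𝓝 0) := by
  -- The increments of `f²` are dominated by `∫ |2f| w`, so `f(x)²` is at most the integral of `h`
  -- over `[x, x + 1]`. That integral vanishes at infinity because `h` is integrable.
  set h : ℝ → ℝ := fun t => |2 * f t| * w t + f t ^ 2 with hh
  have hfi : IntegrableOn (fun t => f t ^ 2) (Ioi 0) := hf2.integrable_sq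
  have hfwi : IntegrableOn (fun t => |2 * f t| * w t) (Ioi 0) :=
    MemLp.integrable_mul (hf2.const_mul 2).norm hw2
  have hhi : IntegrableOn h (Ioi 0) := hfwi.add hfi
  have hint : ∀ {g : ℝ → ℝ}, IntegrableOn g (Ioi 0) → ∀ x y, 0 ≤ x → x ≤ y →
      IntervalIntegrable g volume x y := fun hg x y hx hxy =>
    (intervalIntegrable_iff_integrableOn_Ioc_of_le hxy).2
      (hg.mono_set fun t ht => lt_of_le_of_lt hx ht.1)
  have hinc : ∀ x y, 0 ≤ x → x ≤ y → |f y ^ 2 - f x ^ 2| ≤ ∫ t in x..y, |2 * f t| * w t := by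
    intro x y hx hxy
    refine abs_comp_sub_le_integral (Ψ := fun r => r ^ 2) (ψ := fun r => 2 * r) hxy ?_ hw0
      (hf.mono fun t ht => hx.trans ht.1) (fun p hp q _ hpq => hfw p q (hx.trans hp.1) hpq)
      (fun r => by simpa using hasDerivAt_pow 2 r) (by fun_prop)
    rw [intervalIntegrable_iff_integrableOn_Ioc_of_le hxy]
    exact ((hw2.mono_measure (Measure.restrict_mono_set _
      fun t ht => lt_of_le_of_lt hx ht.1)).integrable (by norm_num))
  have htail := intervalIntegral_tendsto_integral_Ioi 0 hhi tendsto_id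
  have hsq : Tendsto (fun t => f t ^ 2) atTop (𝓝 0) := by
    rw [Metric.tendsto_atTop]
    intro ε hε
    obtain ⟨N, hN⟩ := Metric.cauchySeq_iff.1 htail.cauchySeq (ε / 2) (by positivity)
    refine ⟨max N 0, fun x hx => ?_⟩
    have hx0 : 0 ≤ x := (le_max_right _ _).trans hx
    have hxN : N ≤ x := (le_max_left _ _).trans hx
    have hsmall : ∫ t in x..x + 1, h t < ε / 2 := by
      have := hN (x + 1) (by linarith) x hxN
      rw [Real.dist_eq, id, id, intervalIntegral.integral_interval_sub_left
        (hint hhi _ _ le_rfl (by linarith)) (hint hhi _ _ le_rfl hx0)] at this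
      exact (le_abs_self _).trans_lt this
    have hI1 := hint hfwi x (x + 1) hx0 (by linarith)
    have hI2 := hint hfi x (x + 1) hx0 (by linarith)
    rw [hh, intervalIntegral.integral_add hI1 hI2] at hsmall
    have hn1 : 0 ≤ ∫ t in x..x + 1, |2 * f t| * w t :=
      intervalIntegral.integral_nonneg (by linarith)
        fun t _ => mul_nonneg (abs_nonneg _) (hw0 t)
    have hlow : f x ^ 2 - (∫ t in x..x + 1, |2 * f t| * w t) ≤ ∫ t in x..x + 1, f t ^ 2 := by
      have : ∫ t in x..x + 1, (f x ^ 2 - ∫ t in x..x + 1, |2 * f t| * w t)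
          ≤ ∫ t in x..x + 1, f t ^ 2 := by
        refine intervalIntegral.integral_mono_on (by linarith) (by simp) hI2 fun t ht => ?_
        have h1 := (abs_le.1 (hinc x t hx0 ht.1)).1
        have h2 : ∫ s in x..t, |2 * f s| * w s ≤ ∫ s in x..x + 1, |2 * f s| * w s :=
          intervalIntegral.integral_mono_interval le_rfl ht.1 ht.2
            (Eventually.of_forall fun s => mul_nonneg (abs_nonneg _) (hw0 s)) hI1
        linarith
      simpa using this
    rw [Real.dist_eq, sub_zero, abs_of_nonneg (sq_nonneg _)]
    linarith
  have := hsq.sqrt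
  simpa [Real.sqrt_sq (hf0 _)] using this

/-- A nonnegative continuous function on `[0, ∞)` tending to zero attains its maximum. -/
theorem exists_isMaxOn_Ici_of_tendsto_zero {f : ℝ → ℝ} (hf0 : ∀ t, 0 ≤ f t)
    (hf : ContinuousOn f (Ici 0)) (hlim : Tendsto f atTop (𝓝 0)) :
    ∃ x ∈ Ici (0 : ℝ), IsMaxOn f (Ici 0) x := by
  by_cases h : ∃ x ∈ Ici (0 : ℝ), 0 < f x
  · obtain ⟨x, hx, hpos⟩ := h
    obtain ⟨N, hN⟩ := eventually_atTop.1 (hlim.eventually_lt_const hpos)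
    obtain ⟨y, hy, hmax⟩ := isCompact_Icc.exists_isMaxOn
      (nonempty_Icc.2 (show (0 : ℝ) ≤ max x N from hx.trans (le_max_left _ _)))
      (hf.mono fun t ht => ht.1)
    refine ⟨y, hy.1, fun t ht => ?_⟩
    by_cases htN : t ≤ max x N
    · exact hmax ⟨ht, htN⟩
    · have h1 : f t < f x := hN t ((le_max_right x N).trans (not_le.1 htN).le)
      have h2 : f x ≤ f y := hmax ⟨hx, le_max_left _ _⟩
      exact h1.le.trans h2
  · push Not at h
    exact ⟨0, self_mem_Ici, fun t ht => (h t ht).trans (hf0 0)⟩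

/-! ### The calibration and its primitive -/

/-- The calibration of the critical soliton of height `M`, cut off at level `t`. -/
def calib (M t r : ℝ) : ℝ := max 0 (min r (2 * (r - t))) * √((M ^ 4 - r ^ 4) / 3)

/-- The primitive of `calib M t` vanishing at `0`. -/
def calibPrim (M t x : ℝ) : ℝ := ∫ r in (0 : ℝ)..x, calib M t r

theorem continuous_calib (M t : ℝ) : Continuous (calib M t) := by
  unfold calib; fun_prop

theorem calib_nonneg (M t r : ℝ) : 0 ≤ calib M t r :=
  mul_nonneg (le_max_left _ _) (Real.sqrt_nonneg _)

theorem calib_eq_zero {M t r : ℝ} (h : r ≤ t) : calib M t r = 0 := by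
  have : min r (2 * (r - t)) ≤ 0 := (min_le_right _ _).trans (by linarith)
  rw [calib, max_eq_left this, zero_mul]

/-- Without the cutoff this is an equality, the first integral of the soliton equation; the cutoff
only replaces the factor `r` by something in `[0, r]`. -/
theorem three_mul_calib_sq_le {M t r : ℝ} (h0 : 0 ≤ r) (hr : r ≤ M) :
    3 * calib M t r ^ 2 ≤ M ^ 4 * r ^ 2 - r ^ 6 := by
  have h4 : r ^ 4 ≤ M ^ 4 := pow_le_pow_left₀ h0 hr 4
  have hk : max 0 (min r (2 * (r - t))) ^ 2 ≤ r ^ 2 :=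
    pow_le_pow_left₀ (le_max_left _ _) (max_le h0 (min_le_left _ _)) 2
  rw [calib, mul_pow, Real.sq_sqrt (by linarith)]
  nlinarith [mul_le_mul_of_nonneg_right hk (sub_nonneg.2 h4)]

theorem calib_sq_le {M t r : ℝ} (h0 : 0 ≤ r) (hr : r ≤ M) :
    calib M t r ^ 2 ≤ M ^ 4 * r ^ 2 := by
  nlinarith [three_mul_calib_sq_le (t := t) h0 hr, pow_nonneg h0 6, sq_nonneg (calib M t r)]

theorem hasDerivAt_calibPrim (M t r : ℝ) : HasDerivAt (calibPrim M t) (calib M t r) r :=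
  ((continuous_calib M t).integral_hasStrictDerivAt 0 r).hasDerivAt

/-- Flatness below `t` is the purpose of the cutoff: a path need only be followed until `|u| ≤ t`,
not until `u` vanishes. -/
theorem calibPrim_eq_zero {M t x : ℝ} (h0 : 0 ≤ x) (hx : x ≤ t) : calibPrim M t x = 0 := by
  rw [calibPrim]
  have : ∫ r in (0 : ℝ)..x, calib M t r = ∫ r in (0 : ℝ)..x, (0 : ℝ) :=
    intervalIntegral.integral_congr fun r hr => by
      rw [uIcc_of_le h0] at hr
      exact calib_eq_zero (hr.2.trans hx)
  simpa using this

theorem integral_zero_one_sqrt_one_sub_sq : ∫ x in (0 : ℝ)..1, √(1 - x ^ 2) = Real.pi / 4 := by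
  have hc : Continuous fun x : ℝ => √(1 - x ^ 2) := by fun_prop
  have h1 := intervalIntegral.integral_add_adjacent_intervals (μ := volume)
    (hc.intervalIntegrable (-1) 0) (hc.intervalIntegrable 0 1)
  have h2 : ∫ x in (-1 : ℝ)..0, √(1 - x ^ 2) = ∫ x in (0 : ℝ)..1, √(1 - x ^ 2) := by
    have := intervalIntegral.integral_comp_neg (a := (0 : ℝ)) (b := 1) fun x : ℝ => √(1 - x ^ 2)
    simp only [neg_sq, neg_zero] at this
    exact this.symm
  rw [integral_sqrt_one_sub_sq, h2] at h1
  linarith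

/-- The substitution `x = r² / M²` reduces the integral to the area of a quarter disc. -/
theorem integral_mul_sqrt_pow_four_sub {M : ℝ} (hM : 0 ≤ M) :
    ∫ r in (0 : ℝ)..M, r * √(M ^ 4 - r ^ 4) = Real.pi * M ^ 4 / 8 := by
  rcases hM.eq_or_lt with rfl | hM
  · simp
  have h := intervalIntegral.integral_comp_mul_deriv (a := 0) (b := M)
    (f := fun r => r ^ 2 / M ^ 2) (f' := fun r => 2 * r / M ^ 2) (g := fun x => √(1 - x ^ 2))
    (fun r _ => by simpa using (hasDerivAt_pow 2 r).div_const (M ^ 2))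
    (by fun_prop) (by fun_prop)
  have e : ∀ r : ℝ, r * √(M ^ 4 - r ^ 4)
      = M ^ 4 / 2 * (((fun x : ℝ => √(1 - x ^ 2)) ∘ fun r => r ^ 2 / M ^ 2) r * (2 * r / M ^ 2)) := by
    intro r
    have : M ^ 4 - r ^ 4 = (M ^ 2) ^ 2 * (1 - (r ^ 2 / M ^ 2) ^ 2) := by field_simp
    rw [this, Real.sqrt_mul (by positivity), Real.sqrt_sq (by positivity), Function.comp_apply]
    field_simp
  simp_rw [e]
  rw [intervalIntegral.integral_const_mul, h]
  simp only [ne_eq, OfNat.ofNat_ne_zero, not_false_eq_true, zero_pow, zero_div]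
  rw [div_self (by positivity), integral_zero_one_sqrt_one_sub_sq]
  ring

/-- The full graph bounds a right triangle with legs `2t`, of area `2t²`. -/
theorem integral_max_zero_sub_le {M t : ℝ} (hM : 0 ≤ M) (ht : 0 ≤ t) :
    ∫ r in (0 : ℝ)..M, max 0 (2 * t - r) ≤ 2 * t ^ 2 := by
  have hlin : ∀ x : ℝ, ∫ r in (0 : ℝ)..x, (2 * t - r) = 2 * t * x - x ^ 2 / 2 := by
    intro x
    rw [intervalIntegral.integral_sub (by simp) (by simp)]
    simp; ring
  have hlow : ∀ x : ℝ, 0 ≤ x → x ≤ 2 * t →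
      ∫ r in (0 : ℝ)..x, max 0 (2 * t - r) = 2 * t * x - x ^ 2 / 2 := by
    intro x h0 hx
    rw [← hlin]
    refine intervalIntegral.integral_congr fun r hr => ?_
    rw [uIcc_of_le h0] at hr
    exact max_eq_right (by linarith [hr.2])
  have hc : Continuous fun r : ℝ => max 0 (2 * t - r) := by fun_prop
  rcases le_total M (2 * t) with h | h
  · rw [hlow M hM h]; nlinarith [sq_nonneg (2 * t - M)]
  · rw [← intervalIntegral.integral_add_adjacent_intervals (hc.intervalIntegrable 0 (2 * t))
      (hc.intervalIntegrable (2 * t) M), hlow _ (by linarith) le_rfl]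
    have : ∫ r in (2 * t)..M, max 0 (2 * t - r) = ∫ r in (2 * t)..M, (0 : ℝ) := by
      refine intervalIntegral.integral_congr fun r hr => ?_
      rw [uIcc_of_le h] at hr
      exact max_eq_left (by linarith [hr.1])
    rw [this]; simp; nlinarith

/-- The cutoff lowers the factor `r` by at most `max 0 (2t - r)`, and the root `√(M⁴ - r⁴)` is at
most `M²`. The leading term `π M⁴ / (8√3)` is `μ_ℝ M⁴ / 12`. -/
theorem le_calibPrim {M t : ℝ} (hM : 0 ≤ M) (ht : 0 ≤ t) :
    (Real.pi * M ^ 4 / 8 - 2 * M ^ 2 * t ^ 2) / √3 ≤ calibPrim M t M := by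
  have hpt : ∀ r ∈ Icc 0 M, r * √(M ^ 4 - r ^ 4) / √3 - M ^ 2 / √3 * max 0 (2 * t - r)
      ≤ calib M t r := by
    intro r hr
    have hk : r - max 0 (2 * t - r) ≤ max 0 (min r (2 * (r - t))) := by
      rcases le_total (2 * t) r with h | h
      · exact le_max_of_le_right (le_min (by linarith [le_max_left 0 (2 * t - r)])
          (by linarith [le_max_left 0 (2 * t - r)]))
      · exact le_max_of_le_right (le_min (by linarith [le_max_left 0 (2 * t - r)])
          (by linarith [le_max_right 0 (2 * t - r)]))
    have hS : √(M ^ 4 - r ^ 4) ≤ M ^ 2 := by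
      refine Real.sqrt_le_iff.2 ⟨by positivity, ?_⟩
      nlinarith [pow_nonneg hr.1 4]
    have hmul := mul_le_mul_of_nonneg_right hk (Real.sqrt_nonneg (M ^ 4 - r ^ 4))
    have hmul2 := mul_le_mul_of_nonneg_left hS (le_max_left 0 (2 * t - r))
    rw [calib, Real.sqrt_div' _ (by norm_num : (0 : ℝ) ≤ 3), div_mul_eq_mul_div, ← sub_div,
      ← mul_div_assoc]
    exact div_le_div_of_nonneg_right (by nlinarith) (Real.sqrt_nonneg _)
  have hc1 : Continuous fun r : ℝ => r * √(M ^ 4 - r ^ 4) / √3 := by fun_prop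
  have hc2 : Continuous fun r : ℝ => M ^ 2 / √3 * max 0 (2 * t - r) := by fun_prop
  have hmono := intervalIntegral.integral_mono_on (μ := volume) hM
    ((hc1.sub hc2).intervalIntegrable 0 M) ((continuous_calib M t).intervalIntegrable 0 M) hpt
  simp only [Pi.sub_apply] at hmono
  rw [intervalIntegral.integral_sub (hc1.intervalIntegrable 0 M) (hc2.intervalIntegrable 0 M),
    intervalIntegral.integral_div, intervalIntegral.integral_const_mul,
    integral_mul_sqrt_pow_four_sub hM] at hmono
  refine le_trans ?_ hmono
  have h3 : (0 : ℝ) < √3 := by positivity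
  have := mul_le_mul_of_nonneg_left (integral_max_zero_sub_le hM ht)
    (show 0 ≤ M ^ 2 / √3 by positivity)
  calc _ = Real.pi * M ^ 4 / 8 / √3 - M ^ 2 / √3 * (2 * t ^ 2) := by ring
    _ ≤ _ := by linarith

/-! ### Levels below which enough mass lies -/

theorem integrable_ite_le_sq {α : Type*} [MeasurableSpace α] {ν : Measure α} {f : α → ℝ}
    (hf : AEMeasurable f ν) (hf2 : Integrable (fun x => f x ^ 2) ν) (t : ℝ) :
    Integrable (fun x => if f x ≤ t then f x ^ 2 else 0) ν := by
  have hm : Measurable fun r : ℝ => if r ≤ t then r ^ 2 else 0 :=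
    Measurable.ite measurableSet_Iic (by fun_prop) measurable_const
  refine hf2.mono' (hm.comp_aemeasurable hf).aestronglyMeasurable
    (Eventually.of_forall fun x => ?_)
  split_ifs
  · rw [Real.norm_of_nonneg (sq_nonneg _)]
  · simpa using sq_nonneg (f x)

/-- A function bounded below by `σ ^ 3`, on a space of large measure, cannot have too little mass
on all of its sublevel sets. -/
theorem exists_level_le_integral_ite {α : Type*} [MeasurableSpace α] {ν : Measure α}
    [IsFiniteMeasure ν] {f : α → ℝ} (hf : AEMeasurable f ν)
    (hf2 : Integrable (fun x => f x ^ 2) ν) {σ r₀ c A : ℝ} (hσ : 0 < σ) (hr₀ : 0 < r₀)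
    (hc : 0 < c) (hσf : ∀ᵐ x ∂ν, σ ^ 3 ≤ f x) (hA : ∫ x, f x ^ 2 ∂ν ≤ A)
    (hlarge : A / r₀ ^ 6 + 100 * c * r₀ ^ 2 < ν.real univ) :
    ∃ r, σ ≤ r ∧ r ≤ r₀ ∧ c * r ^ 8 ≤ ∫ x, (if f x ≤ r ^ 3 then f x ^ 2 else 0) ∂ν := by
  by_contra! hcon
  have hlow : ∀ r, 0 < r → r < σ → ν.real {x | f x ≤ r ^ 3} ≤ 100 * c * r ^ 2 := by
    intro r hr hrσ
    have : ν {x | f x ≤ r ^ 3} = 0 := by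
      refine measure_mono_null ?_ (ae_iff.1 hσf)
      intro x hx
      have := pow_lt_pow_left₀ hrσ hr.le (n := 3) (by norm_num)
      exact not_le.2 (lt_of_le_of_lt hx this)
    rw [measureReal_def, this]
    simp only [ENNReal.toReal_zero]
    positivity
  -- Doubling the range of `r` at each step. On the shell `(r/2)³ < f ≤ r³` Markov's inequality
  -- gives measure at most `64 c r²`; the inner set contributes `100 c (r/2)² = 25 c r²`. The total
  -- `89 c r²` stays below `100 c r²`.
  have hind : ∀ n : ℕ, ∀ r, 0 < r → r ≤ r₀ → r < 2 ^ n * σ →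
      ν.real {x | f x ≤ r ^ 3} ≤ 100 * c * r ^ 2 := by
    intro n
    induction n with
    | zero => intro r hr _ hrσ; exact hlow r hr (by simpa using hrσ)
    | succ n ih =>
      intro r hr hrr hrσ
      by_cases hlt : r < σ
      · exact hlow r hr hlt
      have hhalf := ih (r / 2) (by positivity) (by linarith) (by rw [pow_succ] at hrσ; linarith)
      have hη := hcon r (not_lt.1 hlt) hrr
      have hmk := mul_meas_ge_le_integral_of_nonneg
        (Eventually.of_forall fun x => show 0 ≤ (if f x ≤ r ^ 3 then f x ^ 2 else 0) by
          split_ifs <;> positivity) (integrable_ite_le_sq hf hf2 (r ^ 3)) (((r / 2) ^ 3) ^ 2)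
      have hcover : {x | f x ≤ r ^ 3} ⊆ {x | f x ≤ (r / 2) ^ 3} ∪
          {x | ((r / 2) ^ 3) ^ 2 ≤ if f x ≤ r ^ 3 then f x ^ 2 else 0} := by
        intro x hx
        by_cases h : f x ≤ (r / 2) ^ 3
        · exact Or.inl h
        · right
          have hx' : f x ≤ r ^ 3 := hx
          simp only [mem_ofPred_eq, hx', if_true]
          exact pow_le_pow_left₀ (by positivity) (not_le.1 h).le 2
      have hle := (measureReal_mono hcover).trans (measureReal_union_le (μ := ν) _ _)
      set m := ν.real {x | ((r / 2) ^ 3) ^ 2 ≤ if f x ≤ r ^ 3 then f x ^ 2 else 0}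
      have hm : m ≤ 64 * c * r ^ 2 := by
        have h6 : 0 < r ^ 6 := by positivity
        refine le_of_mul_le_mul_left ?_ h6
        nlinarith
      nlinarith [mul_pos hc (sq_pos_of_pos hr)]
  -- At the top level `r₀` the remaining set `f > r₀³` has measure at most `A / r₀⁶`, so the whole
  -- space is smaller than `hlarge` allows.
  obtain ⟨n, hn⟩ := pow_unbounded_of_one_lt (r₀ / σ) (one_lt_two)
  have hm0 := hind n r₀ hr₀ le_rfl ((div_lt_iff₀ hσ).1 hn)
  have hmk := mul_meas_ge_le_integral_of_nonneg
    (Eventually.of_forall fun x => sq_nonneg (f x)) hf2 ((r₀ ^ 3) ^ 2)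
  have hcover : (univ : Set α) ⊆ {x | f x ≤ r₀ ^ 3} ∪ {x | (r₀ ^ 3) ^ 2 ≤ f x ^ 2} := by
    intro x _
    by_cases h : f x ≤ r₀ ^ 3
    · exact Or.inl h
    · exact Or.inr (pow_le_pow_left₀ (by positivity) (not_le.1 h).le 2)
  have hle := (measureReal_mono hcover).trans (measureReal_union_le (μ := ν) _ _)
  have : ν.real {x | (r₀ ^ 3) ^ 2 ≤ f x ^ 2} ≤ A / r₀ ^ 6 := by
    rw [le_div_iff₀ (by positivity)]
    nlinarith
  linarith

/-! ### The calibration inequality on one edge -/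

/-- The calibration inequality integrated over one edge. -/
theorem IsSobolevH1.integral_pow_six_add_le {s : Set ℝ} {u du : ℝ → ℂ} (h : IsSobolevH1 s u du)
    (hs : MeasurableSet s) {M t a : ℝ} (hM : ∀ x ∈ s, ‖u x‖ ≤ M) :
    IntegrableOn (fun x => calib M t ‖u x‖ * ‖du x‖) s ∧
    a ^ 2 * (∫ x in s, ‖u x‖ ^ 6) + 6 * a * (∫ x in s, calib M t ‖u x‖ * ‖du x‖)
      ≤ 3 * (∫ x in s, ‖du x‖ ^ 2)
        + a ^ 2 * M ^ 4 * ((∫ x in s, ‖u x‖ ^ 2) - ∫ x in s, if ‖u x‖ ≤ t then ‖u x‖ ^ 2 else 0)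
        + a ^ 2 * t ^ 4 * ∫ x in s, if ‖u x‖ ≤ t then ‖u x‖ ^ 2 else 0 := by
  have hum : AEStronglyMeasurable (fun x => ‖u x‖) (volume.restrict s) :=
    h.memLp.aestronglyMeasurable.norm
  have hdm : AEStronglyMeasurable (fun x => ‖du x‖) (volume.restrict s) :=
    h.memLp_deriv.aestronglyMeasurable.norm
  have hu2 : IntegrableOn (fun x => ‖u x‖ ^ 2) s := h.memLp.norm.integrable_sq
  have hd2 : IntegrableOn (fun x => ‖du x‖ ^ 2) s := h.memLp_deriv.norm.integrable_sq
  have hu6 : IntegrableOn (fun x => ‖u x‖ ^ 6) s := by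
    refine (hu2.const_mul (M ^ 4)).mono' (hum.pow 6) ?_
    filter_upwards [ae_restrict_mem hs] with x hx
    rw [Real.norm_of_nonneg (by positivity)]
    have := pow_le_pow_left₀ (norm_nonneg (u x)) (hM x hx) 4
    nlinarith [mul_le_mul_of_nonneg_right this (sq_nonneg ‖u x‖)]
  have hη : IntegrableOn (fun x => if ‖u x‖ ≤ t then ‖u x‖ ^ 2 else 0) s :=
    integrable_ite_le_sq hum.aemeasurable hu2 t
  have hW : IntegrableOn (fun x => calib M t ‖u x‖ * ‖du x‖) s := by
    refine ((hu2.const_mul (M ^ 4)).add hd2).mono'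
      (((continuous_calib M t).comp_aestronglyMeasurable hum).mul hdm) ?_
    filter_upwards [ae_restrict_mem hs] with x hx
    rw [Real.norm_of_nonneg (mul_nonneg (calib_nonneg _ _ _) (norm_nonneg _)), Pi.add_apply]
    nlinarith [calib_sq_le (t := t) (norm_nonneg (u x)) (hM x hx),
      two_mul_le_add_sq (calib M t ‖u x‖) ‖du x‖, calib_nonneg M t ‖u x‖, norm_nonneg (du x),
      mul_nonneg (calib_nonneg M t ‖u x‖) (norm_nonneg (du x))]
  refine ⟨hW, ?_⟩
  have key : ∫ x in s, (a ^ 2 * ‖u x‖ ^ 6 + 6 * a * (calib M t ‖u x‖ * ‖du x‖))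
      ≤ ∫ x in s, (3 * ‖du x‖ ^ 2
        + a ^ 2 * M ^ 4 * (‖u x‖ ^ 2 - if ‖u x‖ ≤ t then ‖u x‖ ^ 2 else 0)
        + a ^ 2 * t ^ 4 * if ‖u x‖ ≤ t then ‖u x‖ ^ 2 else 0) := by
    refine setIntegral_mono_on ((hu6.const_mul _).add (hW.const_mul _))
      (((hd2.const_mul _).add ((hu2.sub hη).const_mul _)).add (hη.const_mul _)) hs fun x hx => ?_
    have h0 := norm_nonneg (u x)
    -- Below the level the calibration vanishes and `|u|⁶ ≤ t⁴ |u|²`. Above it, the inequality is `3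
    -- (|u'| - a k)² ≥ 0` combined with `3 k² ≤ M⁴ |u|² - |u|⁶`.
    by_cases hxt : ‖u x‖ ≤ t
    · have h4 := mul_le_mul_of_nonneg_left
        (mul_le_mul_of_nonneg_right (pow_le_pow_left₀ h0 hxt 4) (sq_nonneg ‖u x‖)) (sq_nonneg a)
      simp only [calib_eq_zero hxt, hxt, if_true]
      nlinarith [sq_nonneg ‖du x‖]
    · simp only [hxt, if_false]
      have h3 := mul_le_mul_of_nonneg_left
        (three_mul_calib_sq_le (t := t) h0 (hM x hx)) (sq_nonneg a)
      nlinarith [sq_nonneg (‖du x‖ - a * calib M t ‖u x‖)]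
  have hsub : IntegrableOn (fun x => a ^ 2 * M ^ 4 *
      (‖u x‖ ^ 2 - if ‖u x‖ ≤ t then ‖u x‖ ^ 2 else 0)) s := (hu2.sub hη).const_mul _
  have hadd : IntegrableOn (fun x => 3 * ‖du x‖ ^ 2 + a ^ 2 * M ^ 4 *
      (‖u x‖ ^ 2 - if ‖u x‖ ≤ t then ‖u x‖ ^ 2 else 0)) s := (hd2.const_mul _).add hsub
  rw [integral_add (hu6.const_mul _) (hW.const_mul _), integral_add hadd (hη.const_mul _),
    integral_add (hd2.const_mul _) hsub] at key
  simp only [integral_const_mul] at key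
  rwa [integral_sub hu2 hη] at key

/-! ### Edge ends and integration along them -/

namespace MetricGraph

variable {V E H : Type*}

/-- The vertex of an edge end: an edge end is the origin of an edge, the far end of an edge, or
the origin of a half-line. -/
def legVertex (G : MetricGraph V E H) : (E ⊕ E) ⊕ H → V := Sum.elim (Sum.elim G.src G.tgt) G.base

/-- The point at distance `t` from the vertex of an edge end. -/
def legPt (G : MetricGraph V E H) : (E ⊕ E) ⊕ H → ℝ → G.Point
  | .inl (.inl e), t => G.edgePt e t
  | .inl (.inr e), t => G.edgePt e (G.length e - t)
  | .inr h, t => G.rayPt h t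

/-- The parameters of the closed edge carrying an edge end. -/
def legDom (G : MetricGraph V E H) : (E ⊕ E) ⊕ H → Set ℝ
  | .inl (.inl e) => Icc 0 (G.length e)
  | .inl (.inr e) => Icc 0 (G.length e)
  | .inr _ => Ici 0

/-- The parameters of the points up to the midpoint of the edge carrying an edge end. -/
def legHalf (G : MetricGraph V E H) : (E ⊕ E) ⊕ H → Set ℝ
  | .inl (.inl e) => Icc 0 (G.length e / 2)
  | .inl (.inr e) => Icc 0 (G.length e / 2)
  | .inr _ => Ici 0

/-- The edge or half-line carrying an edge end. -/
def legPiece : (E ⊕ E) ⊕ H → E ⊕ H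
  | .inl (.inl e) => .inl e
  | .inl (.inr e) => .inl e
  | .inr h => .inr h

theorem legPt_zero (G : MetricGraph V E H) (p : (E ⊕ E) ⊕ H) :
    G.legPt p 0 = .vertex (G.legVertex p) := by
  rcases p with (e | e) | h
  · exact G.edgePt_zero e
  · simpa [legPt, legVertex] using G.edgePt_length e
  · exact G.rayPt_zero h

/-- Edge ends at a vertex are counted by its degree, a self-loop giving two. If `p` were the only
one at its vertex, the degree would be one. -/
theorem exists_ne_leg_of_not_isTerminal [Finite E] [Finite H] (G : MetricGraph V E H)
    (hG : ∀ v, ¬ G.IsTerminal v) (p : (E ⊕ E) ⊕ H) :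
    ∃ q, p ≠ q ∧ G.legVertex q = G.legVertex p := by
  set v := G.legVertex p
  have hcard : Nat.card {q // G.legVertex q = v} = G.degree v := by
    rw [Nat.card_congr (Equiv.subtypeSum (p := fun q => G.legVertex q = v)), Nat.card_sum,
      Nat.card_congr (Equiv.subtypeSum (p := fun q => G.legVertex (Sum.inl q) = v)),
      Nat.card_sum]
    rfl
  by_contra! hcon
  refine hG v ?_
  rw [IsTerminal, ← hcard, Nat.card_eq_one_iff_unique]
  refine ⟨⟨fun a b => ?_⟩, ⟨⟨p, rfl⟩⟩⟩
  have ha : p = a.1 := by by_contra h; exact hcon a.1 h a.2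
  have hb : p = b.1 := by by_contra h; exact hcon b.1 h b.2
  exact Subtype.ext (ha.symm.trans hb)

/-- The factor 4 makes `ℓ/2 + 2L ≤ ℓ`: a segment of length `L` beyond any point of the first half of
an edge stays clear of the segment of length `L` at its far end. -/
theorem exists_pos_four_mul_le_length [Finite E] (G : MetricGraph V E H) :
    ∃ L : ℝ, 0 < L ∧ ∀ e, 4 * L ≤ G.length e := by
  rcases isEmpty_or_nonempty E with h | h
  · exact ⟨1, one_pos, fun e => h.elim e⟩
  · obtain ⟨e, he⟩ := Finite.exists_min G.length
    exact ⟨G.length e / 4, by linarith [G.length_pos e], fun e' => by linarith [he e']⟩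

theorem ordConnected_legDom (G : MetricGraph V E H) (p : (E ⊕ E) ⊕ H) :
    (G.legDom p).OrdConnected := by
  rcases p with (e | e) | h
  exacts [ordConnected_Icc, ordConnected_Icc, ordConnected_Ici]

theorem zero_mem_legDom (G : MetricGraph V E H) (p : (E ⊕ E) ⊕ H) : 0 ∈ G.legDom p := by
  rcases p with (e | e) | h
  exacts [⟨le_rfl, (G.length_pos e).le⟩, ⟨le_rfl, (G.length_pos e).le⟩, self_mem_Ici]

theorem nonneg_of_mem_legHalf (G : MetricGraph V E H) {p : (E ⊕ E) ⊕ H} {d : ℝ}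
    (hd : d ∈ G.legHalf p) : 0 ≤ d := by
  rcases p with (e | e) | h
  exacts [hd.1, hd.1, hd]

theorem add_mem_legDom (G : MetricGraph V E H) {L : ℝ} (hL : 0 < L)
    (hLe : ∀ e, 4 * L ≤ G.length e) {p : (E ⊕ E) ⊕ H} {d : ℝ} (hd : d ∈ G.legHalf p) :
    d + L ∈ G.legDom p := by
  have h0 := G.nonneg_of_mem_legHalf hd
  rcases p with (e | e) | h
  · exact ⟨by linarith, by linarith [hd.2, hLe e]⟩
  · exact ⟨by linarith, by linarith [hd.2, hLe e]⟩
  · exact (by linarith : (0 : ℝ) ≤ d + L)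

theorem mem_legDom (G : MetricGraph V E H) {L : ℝ} (hL : 0 < L)
    (hLe : ∀ e, 4 * L ≤ G.length e) (p : (E ⊕ E) ⊕ H) : L ∈ G.legDom p := by
  rcases p with (e | e) | h
  · exact ⟨hL.le, by linarith [hLe e]⟩
  · exact ⟨hL.le, by linarith [hLe e]⟩
  · exact hL.le

/-- Integrability on every edge and half-line. -/
structure IsIntegrable (G : MetricGraph V E H) (F : G.Point → ℝ) : Prop where
  edge : ∀ e, IntegrableOn (fun t => F (G.edgePt e t)) (Ioo 0 (G.length e))
  ray : ∀ h, IntegrableOn (fun t => F (G.rayPt h t)) (Ioi 0)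

theorem IsIntegrable.intervalIntegrable_leg {G : MetricGraph V E H} {F : G.Point → ℝ}
    (hF : G.IsIntegrable F) (p : (E ⊕ E) ⊕ H) {x y : ℝ} (hx : x ∈ G.legDom p)
    (hy : y ∈ G.legDom p) : IntervalIntegrable (fun t => F (G.legPt p t)) volume x y := by
  rcases p with (e | e) | h
  · have := (intervalIntegrable_iff_integrableOn_Ioo_of_le (G.length_pos e).le).2 (hF.edge e)
    exact this.mono_set (by rw [uIcc_of_le (G.length_pos e).le]; exact uIcc_subset_Icc hx hy)
  · have := ((intervalIntegrable_iff_integrableOn_Ioo_of_le (G.length_pos e).le).2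
      (hF.edge e)).comp_sub_left (G.length e)
    rw [sub_zero, sub_self] at this
    exact this.symm.mono_set
      (by rw [uIcc_of_le (G.length_pos e).le]; exact uIcc_subset_Icc hx hy)
  · rw [intervalIntegrable_iff]
    refine (hF.ray h).mono_set fun t ht => ?_
    have : 0 ≤ min x y := le_min hx hy
    exact lt_of_le_of_lt this ht.1

/-- The integral over one edge or half-line. -/
def pieceIntegral (G : MetricGraph V E H) (F : G.Point → ℝ) : E ⊕ H → ℝ
  | .inl e => ∫ t in Ioo (0 : ℝ) (G.length e), F (G.edgePt e t)
  | .inr h => ∫ t in Ioi (0 : ℝ), F (G.rayPt h t)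

theorem pieceIntegral_nonneg (G : MetricGraph V E H) {F : G.Point → ℝ} (hF0 : ∀ x, 0 ≤ F x)
    (i : E ⊕ H) : 0 ≤ G.pieceIntegral F i := by
  rcases i with e | h <;> exact integral_nonneg fun t => hF0 _

theorem pieceIntegral_inl (G : MetricGraph V E H) (F : G.Point → ℝ) (e : E) :
    G.pieceIntegral F (.inl e) = ∫ t in (0 : ℝ)..G.length e, F (G.edgePt e t) := by
  rw [intervalIntegral.integral_of_le (G.length_pos e).le, integral_Ioc_eq_integral_Ioo]
  rfl

theorem pieceIntegral_add_le_integral [Fintype E] [Fintype H] (G : MetricGraph V E H)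
    {F : G.Point → ℝ} (hF0 : ∀ x, 0 ≤ F x) {i j : E ⊕ H} (hij : i ≠ j) :
    G.pieceIntegral F i + G.pieceIntegral F j ≤ G.integral F := by
  classical
  have hsum : G.integral F = ∑ i, G.pieceIntegral F i := by
    rw [Fintype.sum_sum_type]; rfl
  rw [hsum, ← Finset.sum_pair hij]
  exact Finset.sum_le_sum_of_subset_of_nonneg (Finset.subset_univ _)
    fun k _ _ => G.pieceIntegral_nonneg hF0 k

theorem pieceIntegral_le_integral [Fintype E] [Fintype H] (G : MetricGraph V E H)
    {F : G.Point → ℝ} (hF0 : ∀ x, 0 ≤ F x) (i : E ⊕ H) :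
    G.pieceIntegral F i ≤ G.integral F := by
  have hsum : G.integral F = ∑ i, G.pieceIntegral F i := by
    rw [Fintype.sum_sum_type]; rfl
  rw [hsum]
  exact Finset.single_le_sum (fun k _ => G.pieceIntegral_nonneg hF0 k) (Finset.mem_univ i)

theorem IsIntegrable.leg_le_pieceIntegral {G : MetricGraph V E H} {F : G.Point → ℝ}
    (hF : G.IsIntegrable F) (hF0 : ∀ x, 0 ≤ F x) (p : (E ⊕ E) ⊕ H) {y : ℝ}
    (hy : y ∈ G.legDom p) :
    ∫ t in (0 : ℝ)..y, F (G.legPt p t) ≤ G.pieceIntegral F (legPiece p) := by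
  rcases p with (e | e) | h
  · rw [legPiece, pieceIntegral_inl]
    exact intervalIntegral.integral_mono_interval le_rfl hy.1 hy.2
      (Eventually.of_forall fun t => hF0 _)
      (hF.intervalIntegrable_leg (.inl (.inl e)) (G.zero_mem_legDom (.inl (.inl e)))
        ⟨(G.length_pos e).le, le_rfl⟩)
  · rw [legPiece, pieceIntegral_inl]
    simp only [legPt]
    rw [intervalIntegral.integral_comp_sub_left (fun t => F (G.edgePt e t)), sub_zero]
    exact intervalIntegral.integral_mono_interval (by linarith [hy.2]) (by linarith [hy.1]) le_rfl
      (Eventually.of_forall fun t => hF0 _)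
      (hF.intervalIntegrable_leg (.inl (.inl e)) (G.zero_mem_legDom (.inl (.inl e)))
        ⟨(G.length_pos e).le, le_rfl⟩)
  · rw [intervalIntegral.integral_of_le hy]
    exact setIntegral_mono_set (hF.ray h) (Eventually.of_forall fun t => hF0 _)
      (Eventually.of_forall fun t ht => ht.1)

/-- Two different edge ends have disjoint initial segments. -/
theorem IsIntegrable.leg_add_leg_le_integral [Fintype E] [Fintype H] {G : MetricGraph V E H}
    {F : G.Point → ℝ} (hF : G.IsIntegrable F) (hF0 : ∀ x, 0 ≤ F x) {L : ℝ} (hL : 0 < L)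
    (hLe : ∀ e, 4 * L ≤ G.length e) {p q : (E ⊕ E) ⊕ H} (hpq : p ≠ q) {d : ℝ}
    (hd : d ∈ G.legHalf p) :
    (∫ t in (0 : ℝ)..d + L, F (G.legPt p t)) + (∫ t in (0 : ℝ)..L, F (G.legPt q t))
      ≤ G.integral F := by
  -- Different edge ends can belong to one edge, as happens for a self-loop. It is then a bounded
  -- edge, and the two segments have total length at most `ℓ/2 + 2L ≤ ℓ`.
  by_cases hne : legPiece p = legPiece q
  · refine le_trans ?_ (G.pieceIntegral_le_integral hF0 (legPiece p))
    have hpd := add_mem_legDom G hL hLe hd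
    have hqd := G.mem_legDom hL hLe q
    have h0 := G.zero_mem_legDom
    have hrev : ∀ e x, ∫ t in (0 : ℝ)..x, F (G.legPt (.inl (.inr e)) t)
        = ∫ t in (G.length e - x)..G.length e, F (G.edgePt e t) := by
      intro e x
      simp only [legPt]
      rw [intervalIntegral.integral_comp_sub_left (fun t => F (G.edgePt e t)), sub_zero]
    have hcombine : ∀ e x y, x ∈ Icc 0 (G.length e) → y ∈ Icc 0 (G.length e) →
        x + y ≤ G.length e →
        (∫ t in (0 : ℝ)..x, F (G.legPt (.inl (.inl e)) t))
          + (∫ t in (0 : ℝ)..y, F (G.legPt (.inl (.inr e)) t))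
        ≤ G.pieceIntegral F (.inl e) := by
      intro e x y hx hy hxy
      rw [hrev, pieceIntegral_inl]
      have hI : ∀ a ∈ Icc 0 (G.length e), ∀ b ∈ Icc 0 (G.length e),
          IntervalIntegrable (fun t => F (G.edgePt e t)) volume a b := fun a ha b hb =>
        hF.intervalIntegrable_leg (.inl (.inl e)) ha hb
      have hz : (0 : ℝ) ∈ Icc 0 (G.length e) := ⟨le_rfl, (G.length_pos e).le⟩
      have hl : G.length e ∈ Icc 0 (G.length e) := ⟨(G.length_pos e).le, le_rfl⟩
      rw [← intervalIntegral.integral_add_adjacent_intervals (hI 0 hz x hx) (hI x hx _ hl)]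
      refine add_le_add_right ?_ _
      exact intervalIntegral.integral_mono_interval (by linarith) (by linarith [hy.1]) le_rfl
        (Eventually.of_forall fun t => hF0 _) (hI x hx _ hl)
    rcases p with (e | e) | h <;> rcases q with (e' | e') | h' <;>
      simp only [legPiece, Sum.inl.injEq, Sum.inr.injEq, reduceCtorEq] at hne <;>
      subst hne <;> first | exact absurd rfl hpq | skip
    · exact hcombine e _ _ hpd hqd (by linarith [hd.2, hLe e])
    · rw [add_comm]
      exact hcombine e _ _ hqd hpd (by linarith [hd.2, hLe e])
  · exact (add_le_add (hF.leg_le_pieceIntegral hF0 p (add_mem_legDom G hL hLe hd))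
      (hF.leg_le_pieceIntegral hF0 q (G.mem_legDom hL hLe q))).trans
      (G.pieceIntegral_add_le_integral hF0 hne)

end MetricGraph

/-! ### `H¹` functions on the graph: maximum, paths, calibration -/

namespace MetricGraph

variable {V E H : Type*} {G : MetricGraph V E H} {u du : G.Point → ℂ}

theorem IsH1.continuousOn_leg (h : G.IsH1 u du) (p : (E ⊕ E) ⊕ H) :
    ContinuousOn (fun t => u (G.legPt p t)) (G.legDom p) := by
  rcases p with (e | e) | k
  · exact h.continuousOn_edge e
  · exact (h.continuousOn_edge e).comp (by fun_prop : ContinuousOn (fun t => G.length e - t) _)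
      fun t ht => ⟨by linarith [ht.2], by linarith [ht.1]⟩
  · exact h.continuousOn_ray k

theorem IsH1.intervalIntegrable_leg (h : G.IsH1 u du) (p : (E ⊕ E) ⊕ H) {x y : ℝ}
    (hx : x ∈ G.legDom p) (hy : y ∈ G.legDom p) (hxy : x ≤ y) :
    IntervalIntegrable (fun t => ‖du (G.legPt p t)‖) volume x y := by
  rcases p with (e | e) | k
  · exact (h.edge e).memLp_deriv.intervalIntegrable_norm hxy (Ioo_subset_Ioo hx.1 hy.2)
  · have := ((h.edge e).memLp_deriv.intervalIntegrable_norm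
      (show G.length e - y ≤ G.length e - x by linarith)
      (Ioo_subset_Ioo (by linarith [hy.2]) (by linarith [hx.1]))).comp_sub_left (G.length e)
    rw [sub_sub_cancel, sub_sub_cancel] at this
    exact this.symm
  · exact (h.ray k).memLp_deriv.intervalIntegrable_norm hxy
      fun t ht => lt_of_le_of_lt hx ht.1

theorem IsH1.norm_sub_leg_le (h : G.IsH1 u du) (p : (E ⊕ E) ⊕ H) {x y : ℝ}
    (hx : x ∈ G.legDom p) (hy : y ∈ G.legDom p) (hxy : x ≤ y) :
    ‖u (G.legPt p y) - u (G.legPt p x)‖ ≤ ∫ t in x..y, ‖du (G.legPt p t)‖ := by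
  rcases p with (e | e) | k
  · exact (h.edge e).norm_sub_le measurableSet_Ioo hxy (Ioo_subset_Ioo hx.1 hy.2)
      ((h.continuousOn_edge e).mono (Icc_subset_Icc hx.1 hy.2))
  · simp only [legPt]
    rw [intervalIntegral.integral_comp_sub_left (fun t => ‖du (G.edgePt e t)‖), norm_sub_rev]
    exact (h.edge e).norm_sub_le measurableSet_Ioo (by linarith)
      (Ioo_subset_Ioo (by linarith [hy.2]) (by linarith [hx.1]))
      ((h.continuousOn_edge e).mono (Icc_subset_Icc (by linarith [hy.2]) (by linarith [hx.1])))
  · exact (h.ray k).norm_sub_le measurableSet_Ioi hxy (fun t ht => lt_of_le_of_lt hx ht.1)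
      ((h.continuousOn_ray k).mono fun t ht => le_trans hx ht.1)

/-- The modulus inherits the increment bound of `u` by the reverse triangle inequality, so the chain
rule inequality applies without a weak derivative of `|u|`. -/
theorem IsH1.abs_calibPrim_sub_le (h : G.IsH1 u du) (M t : ℝ) (p : (E ⊕ E) ⊕ H) {x y : ℝ}
    (hx : x ∈ G.legDom p) (hy : y ∈ G.legDom p) (hxy : x ≤ y) :
    |calibPrim M t ‖u (G.legPt p y)‖ - calibPrim M t ‖u (G.legPt p x)‖|
      ≤ ∫ r in x..y, calib M t ‖u (G.legPt p r)‖ * ‖du (G.legPt p r)‖ := by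
  have hsub : Icc x y ⊆ G.legDom p := (G.ordConnected_legDom p).out hx hy
  have := abs_comp_sub_le_integral (f := fun r => ‖u (G.legPt p r)‖) hxy
    (h.intervalIntegrable_leg p hx hy hxy) (fun r => norm_nonneg _)
    ((h.continuousOn_leg p).mono hsub).norm
    (fun a ha b hb hab => (abs_norm_sub_norm_le _ _).trans
      (h.norm_sub_leg_le p (hsub ha) (hsub hb) hab))
    (hasDerivAt_calibPrim M t) (continuous_calib M t)
  simpa only [abs_of_nonneg (calib_nonneg _ _ _)] using this

/-- Compactness suffices on a bounded edge; on a half-line the decay of `u` at infinity replaces it.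
-/
theorem IsH1.exists_isMaxOn_legHalf (h : G.IsH1 u du) (p : (E ⊕ E) ⊕ H) :
    ∃ d ∈ G.legHalf p, IsMaxOn (fun t => ‖u (G.legPt p t)‖) (G.legHalf p) d := by
  have hc := (h.continuousOn_leg p).norm
  rcases p with (e | e) | k
  · have := G.length_pos e
    exact isCompact_Icc.exists_isMaxOn (nonempty_Icc.2 (by linarith))
      (hc.mono (Icc_subset_Icc le_rfl (by linarith)))
  · have := G.length_pos e
    exact isCompact_Icc.exists_isMaxOn (nonempty_Icc.2 (by linarith))
      (hc.mono (Icc_subset_Icc le_rfl (by linarith)))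
  · refine exists_isMaxOn_Ici_of_tendsto_zero (fun t => norm_nonneg _) hc ?_
    exact tendsto_zero_of_sub_le (fun t => norm_nonneg _) (fun t => norm_nonneg _) hc
      (h.ray k).memLp.norm (h.ray k).memLp_deriv.norm fun x y hx hxy =>
        (abs_norm_sub_norm_le _ _).trans
          (h.norm_sub_leg_le (.inr k) hx (le_trans hx hxy : (0 : ℝ) ≤ y) hxy)

/-- The modulus of an `H¹` function attains its maximum, at a point which we may describe from the
nearer end of its edge. -/
theorem IsH1.exists_max [Finite E] [Finite H] [Nonempty H] (h : G.IsH1 u du) :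
    ∃ p, ∃ d ∈ G.legHalf p, ∀ q, ∀ t ∈ G.legDom q, ‖u (G.legPt q t)‖ ≤ ‖u (G.legPt p d)‖ := by
  choose d hd hmax using h.exists_isMaxOn_legHalf
  obtain ⟨p, hp⟩ := Finite.exists_max fun p => ‖u (G.legPt p (d p))‖
  refine ⟨p, d p, hd p, ?_⟩
  have hhalf : ∀ q, ∀ t ∈ G.legHalf q, ‖u (G.legPt q t)‖ ≤ ‖u (G.legPt p (d p))‖ :=
    fun q t ht => (hmax q ht).trans (hp q)
  intro q t ht
  rcases q with (e | e) | k
  · rcases le_total t (G.length e / 2) with hle | hle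
    · exact hhalf (.inl (.inl e)) t ⟨ht.1, hle⟩
    · simpa [legPt] using hhalf (.inl (.inr e)) (G.length e - t)
        ⟨by linarith [ht.2], by linarith⟩
  · rcases le_total t (G.length e / 2) with hle | hle
    · exact hhalf (.inl (.inr e)) t ⟨ht.1, hle⟩
    · exact hhalf (.inl (.inl e)) (G.length e - t) ⟨by linarith [ht.2], by linarith⟩
  · exact hhalf (.inr k) t ht

/-- Two disjoint paths lead from a maximum point to points of height at most `t`. -/
theorem IsH1.two_mul_calibPrim_le [Fintype E] [Fintype H] (h : G.IsH1 u du) {M t L : ℝ}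
    (hW : G.IsIntegrable fun x => calib M t ‖u x‖ * ‖du x‖) (hL : 0 < L)
    (hLe : ∀ e, 4 * L ≤ G.length e) {p q : (E ⊕ E) ⊕ H} (hpq : p ≠ q)
    (hv : G.legVertex q = G.legVertex p) {d y z : ℝ} (hd : d ∈ G.legHalf p)
    (hM : ‖u (G.legPt p d)‖ = M) (hy : y ∈ Icc d (d + L)) (hyt : ‖u (G.legPt p y)‖ ≤ t)
    (hz : z ∈ Icc 0 L) (hzt : ‖u (G.legPt q z)‖ ≤ t) :
    2 * calibPrim M t M ≤ G.integral fun x => calib M t ‖u x‖ * ‖du x‖ := by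
  have hF0 : ∀ x : G.Point, 0 ≤ calib M t ‖u x‖ * ‖du x‖ := fun x =>
    mul_nonneg (calib_nonneg _ _ _) (norm_nonneg _)
  refine le_trans ?_ (hW.leg_add_leg_le_integral hF0 hL hLe hpq hd)
  have hd0 := G.nonneg_of_mem_legHalf hd
  have hp0 := G.zero_mem_legDom p
  have hq0 := G.zero_mem_legDom q
  have hpL := G.add_mem_legDom hL hLe hd
  have hqL := G.mem_legDom hL hLe q
  have hpd : d ∈ G.legDom p := (G.ordConnected_legDom p).out hp0 hpL ⟨hd0, by linarith⟩
  have hpy : y ∈ G.legDom p := (G.ordConnected_legDom p).out hpd hpL hy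
  have hqz : z ∈ G.legDom q := (G.ordConnected_legDom q).out hq0 hqL hz
  -- One path runs from `d` forward to `y`; the other runs from `d` back to the vertex and then
  -- along `q` to `z`. The primitive falls from its value at `M` to zero along each.
  have h1 := h.abs_calibPrim_sub_le M t p hp0 hpd hd0
  have h2 := h.abs_calibPrim_sub_le M t p hpd hpy hy.1
  have h3 := h.abs_calibPrim_sub_le M t q hq0 hqz hz.1
  rw [calibPrim_eq_zero (norm_nonneg _) hyt] at h2
  rw [calibPrim_eq_zero (norm_nonneg _) hzt] at h3
  rw [legPt_zero] at h1 h3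
  rw [hv] at h3
  rw [hM] at h1 h2
  have h4 := intervalIntegral.integral_add_adjacent_intervals
    (hW.intervalIntegrable_leg p hp0 hpd) (hW.intervalIntegrable_leg p hpd hpy)
  have h5 := intervalIntegral.integral_mono_interval (μ := volume) le_rfl
    (hd0.trans hy.1) hy.2 (Eventually.of_forall fun r => hF0 (G.legPt p r))
    (hW.intervalIntegrable_leg p hp0 hpL)
  have h6 := intervalIntegral.integral_mono_interval (μ := volume) le_rfl
    hz.1 hz.2 (Eventually.of_forall fun r => hF0 (G.legPt q r))
    (hW.intervalIntegrable_leg q hq0 hqL)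
  have a1 := (abs_le.1 h1).2
  have a2 := (abs_le.1 h2).1
  have a3 := (abs_le.1 h3).1
  linarith

/-- The calibration inequality integrated over the graph. -/
theorem IsH1.integral_pow_six_add_le [Fintype E] [Fintype H] (h : G.IsH1 u du) {M : ℝ}
    (hM : ∀ q, ∀ t ∈ G.legDom q, ‖u (G.legPt q t)‖ ≤ M) (t a : ℝ) :
    (G.IsIntegrable fun x => calib M t ‖u x‖ * ‖du x‖) ∧
    a ^ 2 * G.integral (fun x => ‖u x‖ ^ 6)
        + 6 * a * G.integral (fun x => calib M t ‖u x‖ * ‖du x‖)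
      ≤ 3 * G.integral (fun x => ‖du x‖ ^ 2)
        + a ^ 2 * M ^ 4 * (G.integral (fun x => ‖u x‖ ^ 2)
          - G.integral (fun x => if ‖u x‖ ≤ t then ‖u x‖ ^ 2 else 0))
        + a ^ 2 * t ^ 4 * G.integral (fun x => if ‖u x‖ ≤ t then ‖u x‖ ^ 2 else 0) := by
  have he := fun e => (h.edge e).integral_pow_six_add_le measurableSet_Ioo (t := t) (a := a)
    fun x hx => hM (.inl (.inl e)) x (Ioo_subset_Icc_self hx)
  have hr := fun k => (h.ray k).integral_pow_six_add_le measurableSet_Ioi (t := t) (a := a)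
    fun x hx => hM (.inr k) x (Ioi_subset_Ici_self hx)
  refine ⟨⟨fun e => (he e).1, fun k => (hr k).1⟩, ?_⟩
  have h1 := Finset.sum_le_sum fun e (_ : e ∈ Finset.univ) => (he e).2
  have h2 := Finset.sum_le_sum fun k (_ : k ∈ Finset.univ) => (hr k).2
  simp only [Finset.sum_add_distrib, Finset.sum_sub_distrib, ← Finset.mul_sum] at h1 h2
  simp only [integral]
  linarith

theorem IsH1.isIntegrable_sq (h : G.IsH1 u du) : G.IsIntegrable fun x => ‖u x‖ ^ 2 :=
  ⟨fun e => (h.edge e).memLp.norm.integrable_sq, fun k => (h.ray k).memLp.norm.integrable_sq⟩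

theorem IsH1.isIntegrable_ite (h : G.IsH1 u du) (t : ℝ) :
    G.IsIntegrable fun x => if ‖u x‖ ≤ t then ‖u x‖ ^ 2 else 0 :=
  ⟨fun e => integrable_ite_le_sq (h.edge e).memLp.aestronglyMeasurable.norm.aemeasurable
      (h.isIntegrable_sq.edge e) t,
    fun k => integrable_ite_le_sq (h.ray k).memLp.aestronglyMeasurable.norm.aemeasurable
      (h.isIntegrable_sq.ray k) t⟩

theorem integral_nonneg [Fintype E] [Fintype H] (G : MetricGraph V E H) {F : G.Point → ℝ}
    (hF : ∀ x, 0 ≤ F x) : 0 ≤ G.integral F :=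
  add_nonneg (Finset.sum_nonneg fun _ _ => MeasureTheory.integral_nonneg fun _ => hF _)
    (Finset.sum_nonneg fun _ _ => MeasureTheory.integral_nonneg fun _ => hF _)

theorem integral_mono [Fintype E] [Fintype H] {F F' : G.Point → ℝ} (hF : G.IsIntegrable F)
    (hF' : G.IsIntegrable F') (hle : ∀ x, F x ≤ F' x) : G.integral F ≤ G.integral F' :=
  add_le_add
    (Finset.sum_le_sum fun e _ => MeasureTheory.integral_mono (hF.edge e) (hF'.edge e)
      fun _ => hle _)
    (Finset.sum_le_sum fun k _ => MeasureTheory.integral_mono (hF.ray k) (hF'.ray k)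
      fun _ => hle _)

/-- If `|u|` is bounded below by `σ ^ 3 > 0` on a segment of length `L`, then some level
`r ^ 3 ≥ σ ^ 3` carries mass at least `c r ^ 8` below it. -/
theorem IsH1.exists_level (h : G.IsH1 u du) {p : (E ⊕ E) ⊕ H} {x L σ r₀ c A : ℝ}
    (hL : 0 < L) (hx : x ∈ G.legDom p) (hxL : x + L ∈ G.legDom p)
    (hσ : 0 < σ) (hr₀ : 0 < r₀) (hc : 0 < c)
    (hσf : ∀ t ∈ Icc x (x + L), σ ^ 3 ≤ ‖u (G.legPt p t)‖)
    (hA : ∫ t in x..x + L, ‖u (G.legPt p t)‖ ^ 2 ≤ A)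
    (hlarge : A / r₀ ^ 6 + 100 * c * r₀ ^ 2 < L) :
    ∃ r, σ ≤ r ∧ r ≤ r₀ ∧ c * r ^ 8 ≤
      ∫ t in x..x + L, if ‖u (G.legPt p t)‖ ≤ r ^ 3 then ‖u (G.legPt p t)‖ ^ 2 else 0 := by
  have hle : x ≤ x + L := by linarith
  have hsub : Icc x (x + L) ⊆ G.legDom p := (G.ordConnected_legDom p).out hx hxL
  have hcont := ((h.continuousOn_leg p).mono hsub).norm
  have hm : AEMeasurable (fun t => ‖u (G.legPt p t)‖) (volume.restrict (Ioc x (x + L))) :=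
    (hcont.mono Ioc_subset_Icc_self).aemeasurable measurableSet_Ioc
  have hi : IntegrableOn (fun t => ‖u (G.legPt p t)‖ ^ 2) (Ioc x (x + L)) :=
    ((hcont.pow 2).integrableOn_Icc).mono_set Ioc_subset_Icc_self
  simp only [intervalIntegral.integral_of_le hle] at hA ⊢
  refine exists_level_le_integral_ite hm hi hσ hr₀ hc ?_ hA ?_
  · filter_upwards [ae_restrict_mem measurableSet_Ioc] with t ht
      using hσf t (Ioc_subset_Icc_self ht)
  · simpa [measureReal_def, hL.le] using hlarge

end MetricGraph

/-! ### Constants and error terms -/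

theorem criticalMassReal_pos : 0 < criticalMassReal := by
  unfold criticalMassReal; positivity

/-- Algebraic conclusion of the calibration argument, with `θ = η / 2`. -/
theorem le_of_calibration {I D K M t η μ : ℝ} (hη : 0 ≤ η) (hημ : η ≤ μ) (hμ : 0 < μ)
    (hμ' : μ ≤ criticalMassReal)
    (h1 : ∀ a : ℝ, a ^ 2 * I + 6 * a * K
      ≤ 3 * D + a ^ 2 * M ^ 4 * (μ - η) + a ^ 2 * t ^ 4 * η)
    (h2 : 2 * ((Real.pi * M ^ 4 / 8 - 2 * M ^ 2 * t ^ 2) / √3) ≤ K) :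
    I ≤ 3 * ((μ - η / 2) / criticalMassReal) ^ 2 * D
      + (14 * M ^ 2 * t ^ 2 - M ^ 4 * η / 2 + t ^ 4 * η) := by
  have hm0 := criticalMassReal_pos
  set b := (μ - η / 2) / criticalMassReal with hb
  have hb0 : 0 < b := div_pos (by linarith) hm0
  have hb1 : b ≤ 1 := (div_le_one hm0).2 (by linarith)
  have hbm : b * criticalMassReal = μ - η / 2 := div_mul_cancel₀ _ hm0.ne'
  have h3 : (√3) ^ 2 = 3 := Real.sq_sqrt (by norm_num)
  have hs0 : 0 < √3 := by positivity
  have hs : √3 ≤ 7 / 4 := Real.sqrt_le_iff.2 ⟨by norm_num, by norm_num⟩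
  have e : 2 * ((Real.pi * M ^ 4 / 8 - 2 * M ^ 2 * t ^ 2) / √3)
      = (M ^ 4 * criticalMassReal - 8 * √3 * M ^ 2 * t ^ 2) / 6 := by
    rw [criticalMassReal]
    field_simp
    linear_combination (8 * M ^ 2 * (-Real.pi * M ^ 2 + 16 * t ^ 2)) * h3
  rw [e] at h2
  -- The error constant is `14 = 8 · 7/4`, from `b ≤ 1` and `√3 ≤ 7/4`. The bound `b ≤ 1` is where
  -- `μ ≤ μ_ℝ` enters.
  have hK : M ^ 4 * (μ - η / 2) - 14 * M ^ 2 * t ^ 2 ≤ 6 * b * K := by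
    have k1 := mul_le_mul_of_nonneg_left h2 (show 0 ≤ 6 * b by positivity)
    have k2 : b * √3 ≤ 7 / 4 := by nlinarith
    have k3 := mul_le_mul_of_nonneg_right k2 (show 0 ≤ 8 * M ^ 2 * t ^ 2 by positivity)
    have k4 : 6 * b * ((M ^ 4 * criticalMassReal - 8 * √3 * M ^ 2 * t ^ 2) / 6)
        = M ^ 4 * (μ - η / 2) - b * √3 * (8 * M ^ 2 * t ^ 2) := by
      rw [← hbm]; ring
    linarith
  -- With `a = b⁻¹`, the terms in `M⁴` leave `(μ - η) - (μ - η/2) = -η/2`, the negative term that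
  -- absorbs the error.
  have k5 := mul_le_mul_of_nonneg_left (h1 b⁻¹) (sq_nonneg b)
  have k6 : b ^ 2 * (b⁻¹ ^ 2 * I + 6 * b⁻¹ * K) = I + 6 * b * K := by field_simp
  have k7 : b ^ 2 * (3 * D + b⁻¹ ^ 2 * M ^ 4 * (μ - η) + b⁻¹ ^ 2 * t ^ 4 * η)
      = 3 * b ^ 2 * D + M ^ 4 * (μ - η) + t ^ 4 * η := by field_simp
  rw [k6, k7] at k5
  nlinarith

/-- A mass bound from below on a sublevel set absorbs the errors of the calibration argument. -/
theorem error_le_sqrt {M r η m c r₀ : ℝ} (hr : 0 < r) (hr₀ : r ≤ r₀) (hc : 0 < c)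
    (hη : c * r ^ 8 ≤ η) (hηm : η ≤ m) :
    14 * M ^ 2 * (r ^ 3) ^ 2 - M ^ 4 * η / 2 + (r ^ 3) ^ 4 * η
      ≤ (98 / √(c ^ 3) + r₀ ^ 12 * √m) * √η := by
  have hη0 : 0 < η := lt_of_lt_of_le (by positivity) hη
  have hy : 0 < √η := Real.sqrt_pos.2 hη0
  have hy2 : √η ^ 2 = η := Real.sq_sqrt hη0.le
  have hym : √η ≤ √m := Real.sqrt_le_sqrt hηm
  have hB : 0 < √(c ^ 3) := Real.sqrt_pos.2 (by positivity)
  have hB2 : √(c ^ 3) ^ 2 = c ^ 3 := Real.sq_sqrt (by positivity)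
  -- The cube of `c r⁸ ≤ η`, under a square root. The exponent 8 is chosen so that `r¹² / η` is of
  -- order `√η`.
  have h12 : r ^ 12 * √(c ^ 3) ≤ η * √η := by
    refine le_of_sq_le_sq ?_ (by positivity)
    have h3 := pow_le_pow_left₀ (by positivity) hη 3
    calc (r ^ 12 * √(c ^ 3)) ^ 2 = (c * r ^ 8) ^ 3 := by rw [mul_pow, hB2]; ring
      _ ≤ η ^ 3 := h3
      _ = (η * √η) ^ 2 := by rw [mul_pow, hy2]; ring
  -- As a quadratic in `M²`, the left side has maximum `98 r¹² / η`, so the bound is uniform in `M`.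
  have hmain : 14 * M ^ 2 * (r ^ 3) ^ 2 - M ^ 4 * η / 2 ≤ 98 / √(c ^ 3) * √η := by
    have h1 : 98 * r ^ 12 / η ≤ 98 / √(c ^ 3) * √η := by
      rw [div_le_iff₀ hη0, div_mul_eq_mul_div, div_mul_eq_mul_div, le_div_iff₀ hB]
      nlinarith
    refine le_trans ?_ h1
    rw [le_div_iff₀ hη0]
    nlinarith [sq_nonneg (M ^ 2 * η - 14 * r ^ 6)]
  have hlow : (r ^ 3) ^ 4 * η ≤ r₀ ^ 12 * √m * √η := by
    have h1 : r ^ 12 ≤ r₀ ^ 12 := pow_le_pow_left₀ hr.le hr₀ 12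
    calc (r ^ 3) ^ 4 * η = r ^ 12 * (√η * √η) := by rw [← sq, hy2]; ring
      _ ≤ r₀ ^ 12 * (√m * √η) :=
        mul_le_mul h1 (mul_le_mul_of_nonneg_right hym hy.le) (by positivity)
          (le_trans (by positivity) h1)
      _ = _ := by ring
  rw [add_mul]
  linarith

/-! ### A common level for the two paths -/

namespace MetricGraph

variable {V E H : Type*} {G : MetricGraph V E H} {u du : G.Point → ℂ}

/-- Two segments of length `L`, contained in the graph, both meet a sublevel set `{|u| ≤ t}` where
`t = 0` or the mass of the sublevel set is not too small. -/
theorem IsH1.exists_level_two_legs [Fintype E] [Fintype H] (h : G.IsH1 u du) {L r₀ c A : ℝ}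
    (hL : 0 < L) (hLe : ∀ e, 4 * L ≤ G.length e) {p q : (E ⊕ E) ⊕ H} (hpq : p ≠ q) {d : ℝ}
    (hd : d ∈ G.legHalf p) (hr₀ : 0 < r₀) (hc : 0 < c)
    (hA : G.integral (fun x => ‖u x‖ ^ 2) ≤ A) (hlarge : A / r₀ ^ 6 + 100 * c * r₀ ^ 2 < L) :
    ∃ r, 0 ≤ r ∧ r ≤ r₀ ∧ (∃ y ∈ Icc d (d + L), ‖u (G.legPt p y)‖ ≤ r ^ 3) ∧
      (∃ z ∈ Icc 0 L, ‖u (G.legPt q z)‖ ≤ r ^ 3) ∧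
      (r = 0 ∨ c * r ^ 8 ≤
        G.integral fun x => if ‖u x‖ ≤ r ^ 3 then ‖u x‖ ^ 2 else 0) := by
  have hd0 := G.nonneg_of_mem_legHalf hd
  have hp0 := G.zero_mem_legDom p
  have hq0 := G.zero_mem_legDom q
  have hpL := G.add_mem_legDom hL hLe hd
  have hqL := G.mem_legDom hL hLe q
  have hpd : d ∈ G.legDom p := (G.ordConnected_legDom p).out hp0 hpL ⟨hd0, by linarith⟩
  have hseg : ∀ F : G.Point → ℝ, G.IsIntegrable F → (∀ x, 0 ≤ F x) →
      ∫ t in d..d + L, F (G.legPt p t) ≤ G.integral F ∧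
      ∫ t in (0 : ℝ)..0 + L, F (G.legPt q t) ≤ G.integral F := by
    intro F hF hF0
    have h1 := hF.leg_add_leg_le_integral hF0 hL hLe hpq hd
    have h2 : 0 ≤ ∫ t in (0 : ℝ)..L, F (G.legPt q t) :=
      intervalIntegral.integral_nonneg hL.le fun t _ => hF0 _
    have h3 : 0 ≤ ∫ t in (0 : ℝ)..d + L, F (G.legPt p t) :=
      intervalIntegral.integral_nonneg (by linarith) fun t _ => hF0 _
    have h4 := intervalIntegral.integral_mono_interval (μ := volume) hd0
      (show d ≤ d + L by linarith) le_rfl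
      (Eventually.of_forall fun t => hF0 (G.legPt p t)) (hF.intervalIntegrable_leg p hp0 hpL)
    rw [zero_add]
    exact ⟨by linarith, by linarith⟩
  have hsq := hseg _ h.isIntegrable_sq fun x => sq_nonneg _
  have hite := fun r => hseg _ (h.isIntegrable_ite (r ^ 3)) fun x => by split_ifs <;> positivity
  obtain ⟨y, hy, hymin⟩ := isCompact_Icc.exists_isMinOn
    (nonempty_Icc.2 (show d ≤ d + L by linarith))
    (((h.continuousOn_leg p).mono ((G.ordConnected_legDom p).out hpd hpL)).norm)
  obtain ⟨z, hz, hzmin⟩ := isCompact_Icc.exists_isMinOn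
    (nonempty_Icc.2 hL.le)
    (((h.continuousOn_leg q).mono ((G.ordConnected_legDom q).out hq0 hqL)).norm)
  have hroot : ∀ s : ℝ, 0 ≤ s → ∃ σ : ℝ, 0 ≤ σ ∧ σ ^ 3 = s := fun s hs =>
    ⟨s ^ ((3 : ℕ) : ℝ)⁻¹, by positivity, Real.rpow_inv_natCast_pow hs (by norm_num)⟩
  -- The segment with the larger minimum `σ³` determines the level: any `r ≥ σ` is then reached on
  -- both segments, and `|u| ≥ σ³` on that one. If `σ = 0`, both minima vanish and `r = 0` is taken.
  rcases le_total ‖u (G.legPt q z)‖ ‖u (G.legPt p y)‖ with hle | hle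
  · obtain ⟨σ, hσ0, hσ⟩ := hroot _ (norm_nonneg (u (G.legPt p y)))
    rcases hσ0.eq_or_lt with rfl | hσpos
    · exact ⟨0, le_rfl, hr₀.le, ⟨y, hy, hσ.ge⟩, ⟨z, hz, hle.trans hσ.ge⟩, Or.inl rfl⟩
    · obtain ⟨r, hσr, hrr, hm⟩ := h.exists_level hL hpd hpL hσpos hr₀ hc
        (fun t ht => hσ.le.trans (hymin ht)) (hsq.1.trans hA) hlarge
      have hpow := pow_le_pow_left₀ hσ0 hσr 3
      rw [hσ] at hpow
      exact ⟨r, hσ0.trans hσr, hrr, ⟨y, hy, hpow⟩, ⟨z, hz, hle.trans hpow⟩,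
        Or.inr (hm.trans (hite r).1)⟩
  · obtain ⟨σ, hσ0, hσ⟩ := hroot _ (norm_nonneg (u (G.legPt q z)))
    rcases hσ0.eq_or_lt with rfl | hσpos
    · exact ⟨0, le_rfl, hr₀.le, ⟨y, hy, hle.trans hσ.ge⟩, ⟨z, hz, hσ.ge⟩, Or.inl rfl⟩
    · obtain ⟨r, hσr, hrr, hm⟩ := h.exists_level hL hq0 (by rwa [zero_add]) hσpos hr₀ hc
        (fun t ht => hσ.le.trans (hzmin (by rwa [zero_add] at ht))) (hsq.2.trans hA) hlarge
      have hpow := pow_le_pow_left₀ hσ0 hσr 3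
      rw [hσ] at hpow
      exact ⟨r, hσ0.trans hσr, hrr, ⟨y, hy, hle.trans hpow⟩, ⟨z, hz, hpow⟩,
        Or.inr (hm.trans (hite r).2)⟩

end MetricGraph

/-! ### The modified Gagliardo–Nirenberg inequality -/

theorem mainTheorem6 {V E H : Type*} [Finite V] [Fintype E] [Fintype H] [Nonempty H]
    (G : MetricGraph V E H) (hG : ∀ v : V, ¬ G.IsTerminal v) :
    ∃ C : ℝ, 0 < C ∧
      ∀ μ : ℝ, 0 < μ → μ ≤ criticalMassReal →
      ∀ u du : G.Point → ℂ, G.IsH1 u du → G.integral (fun x => ‖u x‖ ^ 2) = μ →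
        ∃ θ : ℝ, 0 ≤ θ ∧ θ ≤ μ ∧
          G.integral (fun x => ‖u x‖ ^ 6) ≤
            3 * ((μ - θ) / criticalMassReal) ^ 2 * G.integral (fun x => ‖du x‖ ^ 2)
              + C * θ ^ (1 / 2 : ℝ) := by
  obtain ⟨L, hL, hLe⟩ := G.exists_pos_four_mul_le_length
  have hm0 := criticalMassReal_pos
  -- `r₀` and `c` make each of the two terms in `hlarge` at most `L / 4`. They depend only on `L`,
  -- hence only on the graph.
  set r₀ := max 1 (4 * criticalMassReal / L) with hr₀def
  have hr₀1 : 1 ≤ r₀ := le_max_left _ _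
  have hr₀ : 0 < r₀ := by linarith
  set c := L / (400 * r₀ ^ 2) with hcdef
  have hc : 0 < c := by positivity
  have hlarge : criticalMassReal / r₀ ^ 6 + 100 * c * r₀ ^ 2 < L := by
    have h1 : 100 * c * r₀ ^ 2 = L / 4 := by rw [hcdef]; field_simp; norm_num
    have h2 : criticalMassReal / r₀ ^ 6 ≤ L / 4 := by
      rw [div_le_iff₀ (by positivity)]
      have h3 : 4 * criticalMassReal / L ≤ r₀ := le_max_right _ _
      rw [div_le_iff₀ hL] at h3
      have h4 : r₀ ≤ r₀ ^ 6 := le_self_pow₀ hr₀1 (by norm_num)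
      nlinarith
    linarith
  set C₀ := 98 / √(c ^ 3) + r₀ ^ 12 * √criticalMassReal with hC₀
  have hC₀pos : 0 < C₀ := by positivity
  -- The factor `√2` compensates for `θ = η / 2`.
  refine ⟨C₀ * √2, by positivity, fun μ hμ hμ' u du hu hmass => ?_⟩
  obtain ⟨p, d, hd, hM⟩ := hu.exists_max
  obtain ⟨q, hpq, hv⟩ := G.exists_ne_leg_of_not_isTerminal hG p
  obtain ⟨r, hr, hrr, ⟨y, hy, hyr⟩, ⟨z, hz, hzr⟩, hlev⟩ :=
    hu.exists_level_two_legs hL hLe hpq hd hr₀ hc (hmass.le.trans hμ') hlarge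
  set M := ‖u (G.legPt p d)‖ with hMdef
  set η := G.integral fun x => if ‖u x‖ ≤ r ^ 3 then ‖u x‖ ^ 2 else 0 with hηdef
  have hη0 : 0 ≤ η := G.integral_nonneg fun x => by split_ifs <;> positivity
  have hημ : η ≤ μ := by
    rw [← hmass]
    refine MetricGraph.integral_mono (hu.isIntegrable_ite _) hu.isIntegrable_sq fun x => ?_
    split_ifs
    exacts [le_rfl, sq_nonneg _]
  -- The value `a = 0` below is arbitrary: only the integrability half of that lemma is used, and it
  -- does not involve `a`.
  have hK := ((mul_le_mul_of_nonneg_left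
    (le_calibPrim (M := M) (norm_nonneg _) (pow_nonneg hr 3)) zero_le_two)).trans
    (hu.two_mul_calibPrim_le (hu.integral_pow_six_add_le hM (r ^ 3) 0).1 hL hLe hpq hv hd rfl
      hy hyr hz hzr)
  have hfin := le_of_calibration hη0 hημ hμ hμ'
    (fun a => hmass ▸ (hu.integral_pow_six_add_le hM (r ^ 3) a).2) hK
  refine ⟨η / 2, by positivity, by linarith, hfin.trans (add_le_add_right ?_ _)⟩
  have hsqrt : C₀ * √2 * (η / 2) ^ (1 / 2 : ℝ) = C₀ * √η := by
    rw [← Real.sqrt_eq_rpow, mul_assoc, ← Real.sqrt_mul zero_le_two]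
    congr 2; ring
  rw [hsqrt]
  -- For `r = 0` the level is zero and the error reduces to `-M⁴ η / 2 ≤ 0`, so no lower bound on
  -- `η` is required.
  rcases hr.eq_or_lt with rfl | hrpos
  · have : 0 ≤ M ^ 4 * η / 2 := by positivity
    have : 0 ≤ C₀ * √η := by positivity
    norm_num
    linarith
  · exact error_le_sqrt hrpos hrr hc (hlev.resolve_left hrpos.ne') (hημ.trans hμ')

end
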